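/- **Model.** An instance $\omega$ of multiprocessor multitask scheduling on $N$ identical machines is a finite nonempty set of jobs; job $i$ has a release date $r_i\ge 0$ and finitely many (at least one) tasks with processing times $p_{i,\ell}>0$, each of which is either preemptive or non-preemptive; its workload is $p_i=\sum_\ell p_{i,\ell}$. At each time a machine processes at most one task and a task is processed by at most one machine; no task is processed before the release of its job; different tasks of a job may run in parallel; a preemptive task may be interrupted and resumed on any machine, while a non-preemptive task, once started, runs on its machine without interruption until it is completed. Job $i$ is completed at the time $C_i$ at which its last task is completed, and the cost of a schedule is the total response time $\sum_i (C_i-r_i)$. Let $\mathrm{OPT}(\omega)$ be the infimum of the cost over all feasible schedules. A (deterministic) online algorithm $\mathcal A$ produces a feasible schedule for every instance, where the decisions at time $t$ depend only on the jobs released up to time $t$; $\mathrm{Cost}_{\mathcal A}(\omega)$ is the cost of its schedule. Put $$\alpha(\omega)=\frac{\max_i p_i}{\min_i p_i},\qquad \beta(\omega)=\frac{\eta(\omega)}{\min_i p_i},$$ where $\eta(\omega)$ is the largest processing time of a non-preemptive task ($0$ if there is none). For a class $S$ of instances let $\mathcal{CR}_{\mathcal A}^{S}(\alpha,\beta)$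 be the supremum of $\mathrm{Cost}_{\mathcal A}(\omega)/\mathrm{OPT}(\omega)$ over the $\omega\in S$ with $\alpha(\omega)=\alpha$ and $\beta(\omega)=\beta$. We say that $\mathcal A$ has competitive ratio $o(g(\alpha,\beta))$ on $S$ if for every $\varepsilon>0$ there is an $M$ such that $\mathcal{CR}_{\mathcal A}^{S}(\alpha,\beta)\le\varepsilon\, g(\alpha,\beta)$ whenever $g(\alpha,\beta)\ge M$. **Proposition.** Fix the number $N\ge 1$ of machines. No online algorithm has competitive ratio $o(\ln\alpha+\beta)$ on the class of all instances. More precisely: 1. if $N\ge 2$, no online algorithm has competitive ratio $o(\ln\alpha)$ on the class of instances all of whose jobs consist of a single preemptive task (there $\beta=0$); 2. no online algorithm has competitive ratio $o(\beta)$ on the class of instances all of whose jobs consist of a single non-preemptive task (there $\beta=\alpha$). -/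

import Mathlib

namespace MPMS

/-- A task: its processing time and whether it is non-preemptive. -/
structure JobTask where
  size : ℝ
  size_pos : 0 < size
  nonpreemptive : Bool

/-- A job: its release date and its (nonempty) list of tasks. -/
structure Job where
  release : ℝ
  release_nonneg : 0 ≤ release
  tasks : List JobTask
  tasks_ne : tasks ≠ []

/-- The workload of a job: the sum of the processing times of its tasks. -/
noncomputable def Job.workload (J : Job) : ℝ := (J.tasks.map JobTask.size).sum

/-- An input instance: a finite nonempty list of jobs, numbered in the order of their release
(so that the number of a job reveals nothing about jobs that are released later). -/
structure Input where
  jobs : List Job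
  jobs_ne : jobs ≠ []
  sorted : jobs.Pairwise (fun J K => J.release ≤ K.release)

namespace Input

/-- Largest job workload (a maximum over a finite nonempty set). -/
noncomputable def pmax (ω : Input) : ℝ := sSup {x | ∃ J ∈ ω.jobs, x = J.workload}

/-- Smallest job workload (a minimum over a finite nonempty set). -/
noncomputable def pmin (ω : Input) : ℝ := sInf {x | ∃ J ∈ ω.jobs, x = J.workload}

/-- Largest processing time of a non-preemptive task; it is `0` if there is no such task
(`sSup ∅ = 0` in `ℝ`). -/
noncomputable def eta (ω : Input) : ℝ :=
  sSup {x | ∃ J ∈ ω.jobs, ∃ T ∈ J.tasks, T.nonpreemptive = true ∧ x = T.size}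

/-- Ratio of the largest to the smallest job workload. -/
noncomputable def alpha (ω : Input) : ℝ := ω.pmax / ω.pmin

/-- Ratio of the largest non-preemptive task to the smallest job workload. -/
noncomputable def beta (ω : Input) : ℝ := ω.eta / ω.pmin

/-- What is known at time `t`: the jobs released at or before `t`.  It is a prefix of the list
of jobs. -/
noncomputable def revealed (ω : Input) (t : ℝ) : List Job :=
  ω.jobs.filter (fun J => decide (J.release ≤ t))

end Input

/-- A schedule on `N` identical machines: which task, if any, each machine processes at each
time.  The pair `(i, l)` stands for the `l`-th task of the `i`-th job. -/
abbrev Schedule (N : ℕ) := Fin N → ℝ → Option (ℕ × ℕ)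

/-- The times at which the task `τ` is processed. -/
def Schedule.served {N : ℕ} (σ : Schedule N) (τ : ℕ × ℕ) : Set ℝ := {t | ∃ m, σ m t = some τ}

/-- The completion time of the task `τ` of processing time `p`: the first time by which it has
been processed for `p` units of time. -/
noncomputable def Schedule.completion {N : ℕ} (σ : Schedule N) (τ : ℕ × ℕ) (p : ℝ) : ℝ :=
  sInf {T | MeasureTheory.volume (σ.served τ ∩ Set.Iic T) = ENNReal.ofReal p}

/-- Feasible schedules.  Tasks of one job may run in parallel; preemptive tasks may be interrupted
and resumed on any machine; non-preemptive tasks run on one machine without interruption. -/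
structure Feasible {N : ℕ} (ω : Input) (σ : Schedule N) : Prop where
  /-- only existing tasks are processed, and none before the release of its job -/
  valid : ∀ m t i l, σ m t = some (i, l) →
    ∃ h : i < ω.jobs.length, l < ω.jobs[i].tasks.length ∧ ω.jobs[i].release ≤ t
  measurable : ∀ m τ, MeasurableSet {t | σ m t = some τ}
  /-- a task is processed by at most one machine at a time -/
  single : ∀ m m' t τ, σ m t = some τ → σ m' t = some τ → m = m'
  /-- every task is processed for exactly its processing time -/
  service : ∀ (i : Fin ω.jobs.length) (l : Fin ω.jobs[i].tasks.length),
    MeasureTheory.volume (σ.served (i, l)) = ENNReal.ofReal ω.jobs[i].tasks[l].size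
  /-- every task is completed at some finite time -/
  complete : ∀ (i : Fin ω.jobs.length) (l : Fin ω.jobs[i].tasks.length),
    ∃ T : ℝ, MeasureTheory.volume (σ.served (i, l) ∩ Set.Iic T)
      = ENNReal.ofReal ω.jobs[i].tasks[l].size
  /-- a non-preemptive task is run to completion once it has been started -/
  nonpreempt : ∀ (i : Fin ω.jobs.length) (l : Fin ω.jobs[i].tasks.length),
    ω.jobs[i].tasks[l].nonpreemptive = true →
      ∃ (m : Fin N) (s : ℝ), ∀ (m' : Fin N) (t : ℝ),
        σ m' t = some ((i : ℕ), (l : ℕ)) ↔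
          m' = m ∧ s ≤ t ∧ t < s + ω.jobs[i].tasks[l].size

/-- Completion time of a job: the maximum of the completion times of its tasks. -/
noncomputable def jobCompletion {N : ℕ} (ω : Input) (σ : Schedule N)
    (i : Fin ω.jobs.length) : ℝ :=
  ⨆ l : Fin ω.jobs[i].tasks.length, σ.completion (i, l) ω.jobs[i].tasks[l].size

/-- Total response time. -/
noncomputable def cost {N : ℕ} (ω : Input) (σ : Schedule N) : ℝ :=
  ∑ i : Fin ω.jobs.length, (jobCompletion ω σ i - ω.jobs[i].release)

/-- Optimal offline cost on `N` machines. -/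
noncomputable def opt (N : ℕ) (ω : Input) : ℝ :=
  sInf {c | ∃ σ : Schedule N, Feasible ω σ ∧ c = cost ω σ}

/-- A (deterministic) online algorithm on `N` machines: it produces a feasible schedule for every
instance, and what it does at time `t` depends only on the jobs released up to time `t`. -/
structure OnlineAlgorithm (N : ℕ) where
  run : Input → Schedule N
  feasible : ∀ ω, Feasible ω (run ω)
  causal : ∀ (ω ω' : Input) (t : ℝ), ω.revealed t = ω'.revealed t →
    ∀ m, run ω m t = run ω' m t

/-- Competitive ratio of an online algorithm over the class `S` of instances. -/
noncomputable def competitiveRatio {N : ℕ} (A : OnlineAlgorithm N) (S : Set Input) : ENNReal :=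
  ⨆ ω ∈ S, ENNReal.ofReal (cost ω (A.run ω) / opt N ω)

/-- On the class `S`, the competitive ratio of `A`, as a function of the parameters `(α, β)`, is
`o(g(α, β))` as `g(α, β) → ∞`. -/
def RatioLittleO {N : ℕ} (A : OnlineAlgorithm N) (S : Set Input) (g : ℝ → ℝ → ℝ) : Prop :=
  ∀ ε : ℝ, 0 < ε → ∃ M : ℝ, ∀ a b : ℝ, M ≤ g a b →
    competitiveRatio A {ω | ω ∈ S ∧ ω.alpha = a ∧ ω.beta = b} ≤ ENNReal.ofReal (ε * g a b)

/-- Instances in which every job is a single task, and all tasks are preemptive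
(`np = false`) or all tasks are non-preemptive (`np = true`). -/
def singleTask (np : Bool) : Set Input :=
  {ω | ∀ J ∈ ω.jobs, J.tasks.length = 1 ∧ ∀ T ∈ J.tasks, T.nonpreemptive = np}

end MPMS

/-!
The adversary waits until the online schedule has committed itself and then releases a burst of
unit jobs, `N` per unit of time. During the burst the machines can at best keep up with the unit
jobs, so the (fractional) number of unfinished jobs that the schedule has at the start of the burst
never drops, and every unit of time costs that much; an optimal schedule has at most one job left
to postpone and pays a constant multiple of the length of the burst.

Against non-preemptive tasks, a single long job suffices: once it has been started it blocks a
machine, and unit jobs pile up. Against preemptive tasks there are `n` phases of geometrically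
decreasing length, each with `N * n` short jobs and one long job as long as the phase. By the middle
of a phase the schedule could complete all short jobs, but only by neglecting the long one.
Either some phase is left with `n / 2` short jobs in its middle, or in every phase the long job has
received at most a quarter of its service by then, and the rest of the time does not suffice to
finish it, so that `n / 8` of the long jobs remain at the end. The processing times are within a
factor `exp (O(n))` of each other.
-/

namespace MPMS

open MeasureTheory Set
open scoped Finset

/-! ### Service in feasible schedules -/

section Service

variable {N : ℕ} {ω : Input} {σ : Schedule N}

namespace Schedule

/-- The amount of service that the task `τ` has received up to time `t`. -/
noncomputable def work (σ : Schedule N) (τ : ℕ × ℕ) (t : ℝ) : ℝ :=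
  volume.real (σ.served τ ∩ Iic t)

theorem work_nonneg (σ : Schedule N) (τ : ℕ × ℕ) (t : ℝ) : 0 ≤ σ.work τ t :=
  measureReal_nonneg

theorem served_inter_Iio_congr {σ' : Schedule N} {T : ℝ} (h : ∀ t < T, ∀ m, σ m t = σ' m t)
    (τ : ℕ × ℕ) : σ.served τ ∩ Iio T = σ'.served τ ∩ Iio T :=
  Set.ext fun t => and_congr_left fun ht => exists_congr fun m => by rw [h t ht m]

theorem work_congr {σ' : Schedule N} {T : ℝ} (h : ∀ t < T, ∀ m, σ m t = σ' m t) (τ : ℕ × ℕ) :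
    σ.work τ T = σ'.work τ T := by
  have hIic (ρ : Schedule N) : ρ.work τ T = volume.real (ρ.served τ ∩ Iio T) :=
    measureReal_congr ((ae_eq_refl _).inter Iio_ae_eq_Iic.symm)
  rw [hIic, hIic, served_inter_Iio_congr h]

end Schedule

namespace Feasible

theorem measurableSet_served (hσ : Feasible ω σ) (τ : ℕ × ℕ) : MeasurableSet (σ.served τ) := by
  simpa only [Schedule.served, ofPred_exists] using
    MeasurableSet.iUnion fun m => hσ.measurable m τ

theorem served_subset_Ici_zero (hσ : Feasible ω σ) (τ : ℕ × ℕ) : σ.served τ ⊆ Ici 0 := by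
  rintro t ⟨m, hm⟩
  obtain ⟨_, _, hr⟩ := hσ.valid m t _ _ hm
  exact (Job.release_nonneg _).trans hr

theorem served_subset_Ici_release (hσ : Feasible ω σ) (i : Fin ω.jobs.length) (l : ℕ) :
    σ.served (i, l) ⊆ Ici ω.jobs[i].release := by
  rintro t ⟨m, hm⟩
  obtain ⟨_, _, hr⟩ := hσ.valid m t _ _ hm
  exact hr

theorem work_sub_work (hσ : Feasible ω σ) (τ : ℕ × ℕ) {t t' : ℝ} (h : t ≤ t') :
    σ.work τ t' - σ.work τ t = volume.real (σ.served τ ∩ Ioc t t') := by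
  have hfinite : volume (σ.served τ ∩ Iic t) ≠ ⊤ := by
    have hsub : σ.served τ ∩ Iic t ⊆ Icc 0 t := fun _ hu =>
      ⟨hσ.served_subset_Ici_zero τ hu.1, hu.2⟩
    exact measure_ne_top_of_subset hsub measure_Icc_lt_top.ne
  have hdisj : Disjoint (σ.served τ ∩ Iic t) (σ.served τ ∩ Ioc t t') :=
    (Iic_disjoint_Ioc le_rfl).mono inter_subset_right inter_subset_right
  rw [Schedule.work, ← Iic_union_Ioc_eq_Iic h, inter_union_distrib_left,
    measureReal_union hdisj ((hσ.measurableSet_served τ).inter measurableSet_Ioc) hfinite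
      (measure_ne_top_of_subset inter_subset_right measure_Ioc_lt_top.ne),
    Schedule.work, add_sub_cancel_left]

theorem work_mono (hσ : Feasible ω σ) (τ : ℕ × ℕ) : Monotone (σ.work τ) := fun _ _ h =>
  sub_nonneg.1 (by rw [hσ.work_sub_work τ h]; exact measureReal_nonneg)

theorem work_sub_work_le (hσ : Feasible ω σ) (τ : ℕ × ℕ) {t t' : ℝ} (h : t ≤ t') :
    σ.work τ t' - σ.work τ t ≤ t' - t := by
  rw [hσ.work_sub_work τ h, ← Real.volume_real_Ioc_of_le h]
  exact measureReal_mono inter_subset_right measure_Ioc_lt_top.ne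

theorem work_sub_work_of_Ioc_subset (hσ : Feasible ω σ) {τ : ℕ × ℕ} {t t' : ℝ} (h : t ≤ t')
    (hsub : Ioc t t' ⊆ σ.served τ) : σ.work τ t' - σ.work τ t = t' - t := by
  rw [hσ.work_sub_work τ h, inter_eq_right.2 hsub, Real.volume_real_Ioc_of_le h]

/-- Each machine processes one task at a time, so `N` machines deliver at most `N` units of service
per unit of time. -/
theorem sum_work_sub_work_le (hσ : Feasible ω σ) (Q : Finset (ℕ × ℕ)) {t t' : ℝ} (h : t ≤ t') :
    ∑ τ ∈ Q, (σ.work τ t' - σ.work τ t) ≤ N * (t' - t) := by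
  let on (m : Fin N) (τ : ℕ × ℕ) : Set ℝ := {u | σ m u = some τ} ∩ Ioc t t'
  have hserved (τ : ℕ × ℕ) : σ.served τ ∩ Ioc t t' = ⋃ m, on m τ := by
    simp only [on, Schedule.served, ofPred_exists, iUnion_inter]
  have hmachine (m : Fin N) : ∑ τ ∈ Q, volume.real (on m τ) ≤ t' - t := by
    have hdisj : (Q : Set (ℕ × ℕ)).PairwiseDisjoint (on m) := fun τ _ τ' _ hne =>
      disjoint_left.2 fun u hu hu' => hne (Option.some.inj (hu.1.symm.trans hu'.1))
    rw [← measureReal_biUnion_finset hdisj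
        (fun τ _ => (hσ.measurable m τ).inter measurableSet_Ioc)
        (fun τ _ => measure_ne_top_of_subset inter_subset_right measure_Ioc_lt_top.ne),
      ← Real.volume_real_Ioc_of_le h]
    exact measureReal_mono (iUnion₂_subset fun _ _ => inter_subset_right) measure_Ioc_lt_top.ne
  calc ∑ τ ∈ Q, (σ.work τ t' - σ.work τ t)
      = ∑ τ ∈ Q, volume.real (⋃ m, on m τ) :=
        Finset.sum_congr rfl fun τ _ => by rw [hσ.work_sub_work τ h, hserved]
    _ ≤ ∑ τ ∈ Q, ∑ m, volume.real (on m τ) :=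
        Finset.sum_le_sum fun τ _ => measureReal_iUnion_fintype_le _
    _ = ∑ m, ∑ τ ∈ Q, volume.real (on m τ) := Finset.sum_comm
    _ ≤ ∑ _m : Fin N, (t' - t) := Finset.sum_le_sum fun m _ => hmachine m
    _ = N * (t' - t) := by
        rw [Finset.sum_const, Finset.card_univ, Fintype.card_fin, nsmul_eq_mul]

theorem work_eq_size_of_volume_eq {i : Fin ω.jobs.length} {l : Fin ω.jobs[i].tasks.length} {T : ℝ}
    (hT : volume (σ.served (i, l) ∩ Iic T) = ENNReal.ofReal ω.jobs[i].tasks[l].size) :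
    σ.work (i, l) T = ω.jobs[i].tasks[l].size := by
  rw [Schedule.work, measureReal_def, hT, ENNReal.toReal_ofReal (JobTask.size_pos _).le]

section Task

variable (hσ : Feasible ω σ) (i : Fin ω.jobs.length) (l : Fin ω.jobs[i].tasks.length)
include hσ

theorem work_le_size (t : ℝ) : σ.work (i, l) t ≤ ω.jobs[i].tasks[l].size := by
  refine ENNReal.toReal_le_of_le_ofReal (JobTask.size_pos _).le ?_
  rw [← hσ.service i l]
  exact measure_mono inter_subset_left

theorem work_eq_zero_of_le_release {t : ℝ} (ht : t ≤ ω.jobs[i].release) : σ.work (i, l) t = 0 := by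
  have hsub : σ.served (i, l) ∩ Iic t ⊆ {ω.jobs[i].release} := fun u hu =>
    le_antisymm (le_trans hu.2 ht) (hσ.served_subset_Ici_release i l hu.1)
  rw [Schedule.work, measureReal_def, measure_mono_null hsub Real.volume_singleton,
    ENNReal.toReal_zero]

theorem release_add_work_le {t : ℝ} (ht : ω.jobs[i].release ≤ t) :
    ω.jobs[i].release + σ.work (i, l) t ≤ t := by
  have := hσ.work_sub_work_le (i, l) ht
  rw [hσ.work_eq_zero_of_le_release i l le_rfl] at this
  linarith

theorem release_add_size_le_of_volume_eq {T : ℝ}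
    (hT : volume (σ.served (i, l) ∩ Iic T) = ENNReal.ofReal ω.jobs[i].tasks[l].size) :
    ω.jobs[i].release + ω.jobs[i].tasks[l].size ≤ T := by
  have hwork := work_eq_size_of_volume_eq hT
  have hpos := ω.jobs[i].tasks[l].size_pos
  rcases le_total T ω.jobs[i].release with h | h
  · rw [hσ.work_eq_zero_of_le_release i l h] at hwork
    exact absurd hwork hpos.ne
  · exact hwork ▸ hσ.release_add_work_le i l h

theorem release_add_size_le_completion :
    ω.jobs[i].release + ω.jobs[i].tasks[l].size
      ≤ σ.completion (i, l) ω.jobs[i].tasks[l].size :=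
  le_csInf (hσ.complete i l) fun _ => hσ.release_add_size_le_of_volume_eq i l

theorem completion_le_of_volume_eq {T : ℝ}
    (hT : volume (σ.served (i, l) ∩ Iic T) = ENNReal.ofReal ω.jobs[i].tasks[l].size) :
    σ.completion (i, l) ω.jobs[i].tasks[l].size ≤ T :=
  csInf_le ⟨_, fun _ => hσ.release_add_size_le_of_volume_eq i l⟩ hT

theorem work_eq_size_of_completion_lt {t : ℝ}
    (ht : σ.completion (i, l) ω.jobs[i].tasks[l].size < t) :
    σ.work (i, l) t = ω.jobs[i].tasks[l].size := by
  obtain ⟨T, hT, hTt⟩ := exists_lt_of_csInf_lt (hσ.complete i l) ht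
  refine le_antisymm (hσ.work_le_size i l t) ?_
  exact work_eq_size_of_volume_eq hT ▸ hσ.work_mono (i, l) hTt.le

theorem release_add_size_le_jobCompletion :
    ω.jobs[i].release + ω.jobs[i].tasks[l].size ≤ jobCompletion ω σ i :=
  (hσ.release_add_size_le_completion i l).trans
    (le_ciSup (f := fun l : Fin ω.jobs[i].tasks.length =>
      σ.completion (i, l) ω.jobs[i].tasks[l].size) (finite_range _).bddAbove l)

end Task

end Feasible

theorem exists_pos_le_cost (N : ℕ) (ω : Input) :
    ∃ c > 0, ∀ σ : Schedule N, Feasible ω σ → c ≤ cost ω σ := by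
  have htask (i : Fin ω.jobs.length) : ∃ l, l < ω.jobs[i].tasks.length :=
    ⟨0, List.length_pos_iff.2 ω.jobs[i].tasks_ne⟩
  choose l hl using htask
  have : Nonempty (Fin ω.jobs.length) := ⟨⟨0, List.length_pos_iff.2 ω.jobs_ne⟩⟩
  refine ⟨∑ i, (ω.jobs[i].tasks[l i]'(hl i)).size,
    Finset.sum_pos (fun i _ => JobTask.size_pos _) Finset.univ_nonempty, fun σ hσ => ?_⟩
  exact Finset.sum_le_sum fun i _ =>
    le_sub_iff_add_le'.2 (hσ.release_add_size_le_jobCompletion i ⟨l i, hl i⟩)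

theorem Feasible.opt_pos (hσ : Feasible ω σ) : 0 < opt N ω := by
  obtain ⟨c, hc, hle⟩ := exists_pos_le_cost N ω
  refine hc.trans_le (le_csInf ⟨_, σ, hσ, rfl⟩ ?_)
  rintro _ ⟨σ', hσ', rfl⟩
  exact hle σ' hσ'

theorem Feasible.opt_le_cost (hσ : Feasible ω σ) : opt N ω ≤ cost ω σ := by
  obtain ⟨c, -, hle⟩ := exists_pos_le_cost N ω
  refine csInf_le ⟨c, ?_⟩ ⟨σ, hσ, rfl⟩
  rintro _ ⟨σ', hσ', rfl⟩
  exact hle σ' hσ'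

theorem not_ratioLittleO_of_forall_exists_ge {A : OnlineAlgorithm N} {S : Set Input}
    {g : ℝ → ℝ → ℝ} {c : ℝ} (hc : 0 < c)
    (h : ∀ M : ℝ, ∃ ω ∈ S, M ≤ g ω.alpha ω.beta ∧
      c * g ω.alpha ω.beta ≤ cost ω (A.run ω) / opt N ω) :
    ¬ RatioLittleO A S g := by
  intro hlittle
  obtain ⟨M, hM⟩ := hlittle (c / 2) (half_pos hc)
  obtain ⟨ω, hωS, hg, hratio⟩ := h (max M 1)
  have hg1 : 1 ≤ g ω.alpha ω.beta := (le_max_right _ _).trans hg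
  have hle : ENNReal.ofReal (cost ω (A.run ω) / opt N ω)
      ≤ ENNReal.ofReal (c / 2 * g ω.alpha ω.beta) :=
    (le_iSup₂ (f := fun ω _ => ENNReal.ofReal (cost ω (A.run ω) / opt N ω)) ω
      ⟨hωS, rfl, rfl⟩).trans (hM _ _ ((le_max_left _ _).trans hg))
  have := (ENNReal.ofReal_le_ofReal_iff (by positivity)).1 hle
  nlinarith

end Service

/-! ### Streams of single-task jobs -/

/-- An infinite supply of single-task jobs, ordered by release date: `r` gives the release dates
and `p` the processing times. An instance consists of the first few jobs of a stream. -/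
structure JobStream where
  r : ℕ → ℝ
  p : ℕ → ℝ
  r_nonneg : ∀ i, 0 ≤ r i
  p_pos : ∀ i, 0 < p i
  mono : Monotone r

namespace JobStream

/-- The `i`-th job of a stream; its task is non-preemptive if `np = true`. -/
def job (S : JobStream) (np : Bool) (i : ℕ) : Job where
  release := S.r i
  release_nonneg := S.r_nonneg i
  tasks := [⟨S.p i, S.p_pos i, np⟩]
  tasks_ne := List.cons_ne_nil _ _

/-- The instance that consists of the first `n` jobs of a stream. -/
def input (S : JobStream) (np : Bool) (n : ℕ) (hn : 0 < n) : Input where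
  jobs := (List.range n).map (S.job np)
  jobs_ne := by simpa using hn.ne'
  sorted := List.pairwise_map.2 (List.pairwise_lt_range.imp fun h => S.mono h.le)

variable {S : JobStream} {np : Bool} {n : ℕ} {hn : 0 < n}

theorem length_jobs_input : (S.input np n hn).jobs.length = n := by simp [input]

theorem getElem_jobs_input (i : ℕ) (h : i < (S.input np n hn).jobs.length) :
    (S.input np n hn).jobs[i] = S.job np i := by simp [input]

theorem mem_jobs_input {J : Job} : J ∈ (S.input np n hn).jobs ↔ ∃ i < n, J = S.job np i := by
  simp [input, eq_comm]

theorem workload_job (i : ℕ) : (S.job np i).workload = S.p i := by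
  simp [Job.workload, job]

theorem input_mem_singleTask : S.input np n hn ∈ singleTask np := by
  intro J hJ
  obtain ⟨i, -, rfl⟩ := mem_jobs_input.1 hJ
  simp [job]

theorem pmax_input {k : ℕ} (hk : k < n) (h : ∀ i < n, S.p i ≤ S.p k) :
    (S.input np n hn).pmax = S.p k := by
  refine IsGreatest.csSup_eq ⟨⟨_, mem_jobs_input.2 ⟨k, hk, rfl⟩, (workload_job k).symm⟩, ?_⟩
  rintro _ ⟨J, hJ, rfl⟩
  obtain ⟨i, hi, rfl⟩ := mem_jobs_input.1 hJ
  exact (workload_job i).trans_le (h i hi)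

theorem pmin_input {k : ℕ} (hk : k < n) (h : ∀ i < n, S.p k ≤ S.p i) :
    (S.input np n hn).pmin = S.p k := by
  refine IsLeast.csInf_eq ⟨⟨_, mem_jobs_input.2 ⟨k, hk, rfl⟩, (workload_job k).symm⟩, ?_⟩
  rintro _ ⟨J, hJ, rfl⟩
  obtain ⟨i, hi, rfl⟩ := mem_jobs_input.1 hJ
  exact (h i hi).trans_eq (workload_job i).symm

theorem eta_input {k : ℕ} (hk : k < n) (h : ∀ i < n, S.p i ≤ S.p k) :
    (S.input true n hn).eta = S.p k := by
  refine IsGreatest.csSup_eq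
    ⟨⟨_, mem_jobs_input.2 ⟨k, hk, rfl⟩, _, List.mem_singleton_self _, rfl, rfl⟩, ?_⟩
  rintro _ ⟨J, hJ, T, hT, -, rfl⟩
  obtain ⟨i, hi, rfl⟩ := mem_jobs_input.1 hJ
  rw [List.mem_singleton.1 hT]
  exact h i hi

theorem revealed_input {k : ℕ} {t : ℝ} (hk : k ≤ n) (h : ∀ i, k ≤ i → i < n → t < S.r i) :
    (S.input np n hn).revealed t
      = ((List.range k).map (S.job np)).filter fun J => decide (J.release ≤ t) := by
  obtain ⟨d, rfl⟩ := Nat.exists_eq_add_of_le hk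
  have hlate : ((List.range d).map (S.job np ∘ (k + ·))).filter
      (fun J => decide (J.release ≤ t)) = [] := by
    refine List.filter_eq_nil_iff.2 fun J hJ => ?_
    obtain ⟨i, hi, rfl⟩ := List.mem_map.1 hJ
    have hi := List.mem_range.1 hi
    exact fun hr => (h (k + i) (by omega) (by omega)).not_ge (of_decide_eq_true hr)
  simp only [Input.revealed, input, List.range_add, List.map_append, List.map_map,
    List.filter_append]
  rw [hlate, List.append_nil]

section Feasible

variable {N : ℕ} {σ : Schedule N}

theorem jobCompletion_input (i : Fin (S.input np n hn).jobs.length) :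
    jobCompletion (S.input np n hn) σ i = σ.completion (i, 0) (S.p i) := by
  obtain ⟨i, hi⟩ := i
  have : Nonempty (Fin (S.input np n hn).jobs[i].tasks.length) := ⟨⟨0, by simp [input, job]⟩⟩
  refine (iSup_congr ?_).trans ciSup_const
  rintro ⟨l, hl⟩
  obtain rfl : l = 0 := by simpa [input, job] using hl
  simp [input, job]

theorem cost_input : cost (S.input np n hn) σ
    = ∑ i ∈ Finset.range n, (σ.completion (i, 0) (S.p i) - S.r i) := by
  rw [cost, Finset.sum_range]
  refine Fintype.sum_equiv (finCongr length_jobs_input) _ _ fun i => ?_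
  rw [jobCompletion_input, Fin.getElem_fin, getElem_jobs_input]
  rfl

theorem exists_served_eq_Ico (hσ : Feasible (S.input true n hn) σ) {i : ℕ} (hi : i < n) :
    ∃ s, S.r i ≤ s ∧ σ.served (i, 0) = Ico s (s + S.p i) := by
  have hlen : i < (S.input true n hn).jobs.length := hi.trans_eq length_jobs_input.symm
  obtain ⟨m, s, hs⟩ := hσ.nonpreempt ⟨i, hlen⟩ ⟨0, by simp [input, job]⟩ (by simp [input, job])
  replace hs : ∀ m' t, σ m' t = some (i, 0) ↔ m' = m ∧ s ≤ t ∧ t < s + S.p i := by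
    simpa [input, job] using hs
  have hserved : σ.served (i, 0) = Ico s (s + S.p i) := by
    ext t
    simp [Schedule.served, hs]
  have hmem : s ∈ σ.served (i, 0) := hserved ▸ left_mem_Ico.2 (lt_add_of_pos_right s (S.p_pos i))
  have hrelease := hσ.served_subset_Ici_release ⟨i, hlen⟩ 0 hmem
  exact ⟨s, by simpa [input, job] using hrelease, hserved⟩

variable (hσ : Feasible (S.input np n hn) σ) {i : ℕ} (hi : i < n)
include hσ hi

theorem work_le (t : ℝ) : σ.work (i, 0) t ≤ S.p i := by
  simpa [input, job] using
    hσ.work_le_size ⟨i, hi.trans_eq length_jobs_input.symm⟩ ⟨0, by simp [input, job]⟩ t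

theorem work_eq_zero {t : ℝ} (ht : t ≤ S.r i) : σ.work (i, 0) t = 0 := by
  simpa [input, job] using
    hσ.work_eq_zero_of_le_release ⟨i, hi.trans_eq length_jobs_input.symm⟩
      ⟨0, by simp [input, job]⟩ (by simpa [input, job] using ht)

theorem work_eq_of_completion_lt {t : ℝ} (ht : σ.completion (i, 0) (S.p i) < t) :
    σ.work (i, 0) t = S.p i := by
  simpa [input, job] using
    hσ.work_eq_size_of_completion_lt ⟨i, hi.trans_eq length_jobs_input.symm⟩
      ⟨0, by simp [input, job]⟩ (by simpa [input, job] using ht)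

theorem release_add_le_completion : S.r i + S.p i ≤ σ.completion (i, 0) (S.p i) := by
  simpa [input, job] using
    hσ.release_add_size_le_completion ⟨i, hi.trans_eq length_jobs_input.symm⟩
      ⟨0, by simp [input, job]⟩

theorem completion_le {T : ℝ} (hT : volume (σ.served (i, 0) ∩ Iic T) = ENNReal.ofReal (S.p i)) :
    σ.completion (i, 0) (S.p i) ≤ T := by
  simpa [input, job] using
    hσ.completion_le_of_volume_eq ⟨i, hi.trans_eq length_jobs_input.symm⟩
      ⟨0, by simp [input, job]⟩ (by simpa [input, job] using hT)

end Feasible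

/-- The fractional number of unfinished jobs at time `t`: each of the first `n` jobs that has been
released by then counts with the part of its processing time that is still to be served. -/
noncomputable def pending {N : ℕ} (S : JobStream) (n : ℕ) (σ : Schedule N) (t : ℝ) : ℝ :=
  ∑ i ∈ Finset.range n with S.r i ≤ t, (1 - σ.work (i, 0) t / S.p i)

variable {N : ℕ} {σ : Schedule N}

theorem pending_le_sum_indicator (hσ : Feasible (S.input np n hn) σ) (t : ℝ) :
    S.pending n σ t
      ≤ ∑ i ∈ Finset.range n, (Icc (S.r i) (σ.completion (i, 0) (S.p i))).indicator 1 t := by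
  rw [pending, Finset.sum_filter]
  refine Finset.sum_le_sum fun i hi => ?_
  split_ifs with hr
  · rcases le_or_gt t (σ.completion (i, 0) (S.p i)) with hc | hc
    · rw [indicator_of_mem (mem_Icc.2 ⟨hr, hc⟩), Pi.one_apply]
      exact sub_le_self 1 (div_nonneg (σ.work_nonneg _ t) (S.p_pos i).le)
    · rw [work_eq_of_completion_lt hσ (Finset.mem_range.1 hi) hc, div_self (S.p_pos i).ne',
        sub_self]
      exact indicator_nonneg (fun _ _ => zero_le_one) t
  · exact indicator_nonneg (fun _ _ => zero_le_one) t

theorem mul_le_cost (hσ : Feasible (S.input np n hn) σ) {a b Φ : ℝ} (hab : a ≤ b)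
    (h : ∀ t ∈ Icc a b, Φ ≤ S.pending n σ t) : Φ * (b - a) ≤ cost (S.input np n hn) σ := by
  let alive (i : ℕ) : Set ℝ := Icc (S.r i) (σ.completion (i, 0) (S.p i))
  have hint (i : ℕ) : IntegrableOn ((alive i).indicator 1 : ℝ → ℝ) (Icc a b) :=
    (integrableOn_const measure_Icc_lt_top.ne).indicator measurableSet_Icc
  calc Φ * (b - a) = ∫ _ in Icc a b, Φ := by
        rw [setIntegral_const, Real.volume_real_Icc_of_le hab, smul_eq_mul, mul_comm]
    _ ≤ ∫ t in Icc a b, ∑ i ∈ Finset.range n, (alive i).indicator 1 t :=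
        setIntegral_mono_on (integrableOn_const measure_Icc_lt_top.ne)
          (integrable_finsetSum _ fun i _ => hint i) measurableSet_Icc fun t ht =>
            (h t ht).trans (pending_le_sum_indicator hσ t)
    _ = ∑ i ∈ Finset.range n, volume.real (alive i ∩ Icc a b) := by
        rw [integral_finsetSum _ fun i _ => hint i]
        refine Finset.sum_congr rfl fun i _ => ?_
        rw [integral_indicator_one measurableSet_Icc, measureReal_restrict_apply measurableSet_Icc]
    _ ≤ ∑ i ∈ Finset.range n, (σ.completion (i, 0) (S.p i) - S.r i) := by
        refine Finset.sum_le_sum fun i hi => ?_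
        have hle : S.r i ≤ σ.completion (i, 0) (S.p i) := by
          linarith [release_add_le_completion hσ (Finset.mem_range.1 hi), S.p_pos i]
        rw [← Real.volume_real_Icc_of_le hle]
        exact measureReal_mono inter_subset_left measure_Icc_lt_top.ne
    _ = cost (S.input np n hn) σ := cost_input.symm

end JobStream

namespace JobStream

/-- A way to run each of the first `n` jobs of a stream without interruption: job `i` occupies
machine `machine i` from time `start i` on. -/
structure Plan (S : JobStream) (N n : ℕ) where
  machine : ℕ → Fin N
  start : ℕ → ℝ
  release_le : ∀ i < n, S.r i ≤ start i
  separated : ∀ i j, i < j → j < n → machine i = machine j →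
    start i + S.p i ≤ start j ∨ start j + S.p j ≤ start i

namespace Plan

variable {S : JobStream} {N n : ℕ} (P : S.Plan N n)

/-- The time slot that a plan assigns to job `i`. -/
def slot (i : ℕ) : Set ℝ := Ico (P.start i) (P.start i + S.p i)

theorem measurableSet_slot (i : ℕ) : MeasurableSet (P.slot i) := measurableSet_Ico

open Classical in
/-- The schedule described by a plan. -/
noncomputable def schedule : Schedule N := fun m t =>
  if h : ∃ i < n, P.machine i = m ∧ t ∈ P.slot i then some (h.choose, 0) else none

theorem eq_of_mem_slot {i j : ℕ} (hi : i < n) (hj : j < n) (hm : P.machine i = P.machine j)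
    {t : ℝ} (hti : t ∈ P.slot i) (htj : t ∈ P.slot j) : i = j := by
  obtain ⟨hi₁, hi₂⟩ := hti
  obtain ⟨hj₁, hj₂⟩ := htj
  rcases lt_trichotomy i j with h | h | h
  · rcases P.separated i j h hj hm with h' | h' <;> linarith
  · exact h
  · rcases P.separated j i h hi hm.symm with h' | h' <;> linarith

theorem schedule_eq_some {m : Fin N} {t : ℝ} {i l : ℕ} :
    P.schedule m t = some (i, l) ↔ l = 0 ∧ i < n ∧ P.machine i = m ∧ t ∈ P.slot i := by
  unfold schedule
  split_ifs with h
  · obtain ⟨hlt, hmachine, hslot⟩ := h.choose_spec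
    rw [Option.some.injEq, Prod.mk.injEq]
    constructor
    · rintro ⟨hi, rfl⟩
      rw [← hi]
      exact ⟨rfl, hlt, hmachine, hslot⟩
    · rintro ⟨rfl, hi, hm, ht⟩
      exact ⟨P.eq_of_mem_slot hlt hi (hmachine.trans hm.symm) hslot ht, rfl⟩
  · simp only [false_iff]
    exact fun h' => h ⟨i, h'.2⟩

theorem served_schedule {i : ℕ} (hi : i < n) : P.schedule.served (i, 0) = P.slot i := by
  ext t
  simp [Schedule.served, schedule_eq_some, hi]

theorem volume_served_schedule {i : ℕ} (hi : i < n) :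
    volume (P.schedule.served (i, 0)) = ENNReal.ofReal (S.p i) := by
  rw [P.served_schedule hi, slot, Real.volume_Ico, add_sub_cancel_left]

theorem volume_served_schedule_inter_Iic {i : ℕ} (hi : i < n) :
    volume (P.schedule.served (i, 0) ∩ Iic (P.start i + S.p i)) = ENNReal.ofReal (S.p i) := by
  have hsub : P.schedule.served (i, 0) ⊆ Iic (P.start i + S.p i) := by
    rw [P.served_schedule hi]
    exact fun t ht => ht.2.le
  rw [inter_eq_left.2 hsub, P.volume_served_schedule hi]

theorem feasible_schedule (np : Bool) (hn : 0 < n) : Feasible (S.input np n hn) P.schedule where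
  valid m t i l h := by
    obtain ⟨rfl, hi, -, ht⟩ := P.schedule_eq_some.1 h
    refine ⟨hi.trans_eq length_jobs_input.symm, ?_⟩
    simpa [input, job] using (P.release_le i hi).trans ht.1
  measurable m := by
    rintro ⟨i, l⟩
    simp only [schedule_eq_some]
    by_cases h : l = 0 ∧ i < n ∧ P.machine i = m
    · simpa [h] using P.measurableSet_slot i
    · simp only [← and_assoc] at h ⊢
      simp [h]
  single m m' t := by
    rintro ⟨i, l⟩ h h'
    rw [schedule_eq_some] at h h'
    exact h.2.2.1.symm.trans h'.2.2.1
  service := by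
    rintro ⟨i, hi⟩ ⟨l, hl⟩
    obtain rfl : l = 0 := by simpa [input, job] using hl
    simpa [input, job] using P.volume_served_schedule (hi.trans_eq length_jobs_input)
  complete := by
    rintro ⟨i, hi⟩ ⟨l, hl⟩
    obtain rfl : l = 0 := by simpa [input, job] using hl
    refine ⟨P.start i + S.p i, ?_⟩
    simpa [input, job] using P.volume_served_schedule_inter_Iic (hi.trans_eq length_jobs_input)
  nonpreempt := by
    rintro ⟨i, hi⟩ ⟨l, hl⟩ -
    obtain rfl : l = 0 := by simpa [input, job] using hl
    refine ⟨P.machine i, P.start i, fun m t => ?_⟩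
    have hi : i < n := hi.trans_eq length_jobs_input
    simp [input, job, schedule_eq_some, slot, hi, eq_comm (a := m)]

theorem opt_le (np : Bool) (hn : 0 < n) :
    opt N (S.input np n hn) ≤ ∑ i ∈ Finset.range n, (P.start i + S.p i - S.r i) := by
  have hfeasible := P.feasible_schedule np hn
  refine hfeasible.opt_le_cost.trans ?_
  rw [cost_input]
  refine Finset.sum_le_sum fun i hi => sub_le_sub_right ?_ _
  have hi := Finset.mem_range.1 hi
  exact completion_le hfeasible hi (P.volume_served_schedule_inter_Iic hi)

end Plan

end JobStream

/-! ### The burst of unit jobs -/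

namespace JobStream

variable {S : JobStream} {np : Bool} {N k : ℕ} {T : ℝ}

/-- The adversary's continuation of a stream: after the jobs `0, …, k` the rest of the stream is
replaced, from time `T` on, by a burst of `N` unit jobs per unit of time. -/
noncomputable def burstAfter (S : JobStream) (N k : ℕ) (T : ℝ) (hT : S.r k ≤ T) : JobStream where
  r i := if i ≤ k then S.r i else T + ((i - (k + 1)) / N : ℕ)
  p i := if i ≤ k then S.p i else 1
  r_nonneg i := by
    have hT₀ := (S.r_nonneg k).trans hT
    have hr := S.r_nonneg i
    split_ifs <;> positivity
  p_pos i := by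
    have hp := S.p_pos i
    split_ifs <;> positivity
  mono i j hij := by
    dsimp only
    split_ifs with hi hj hj
    · exact S.mono hij
    · exact (S.mono hi).trans (hT.trans (le_add_of_nonneg_right (Nat.cast_nonneg _)))
    · omega
    · gcongr

/-- The jobs `0, …, k` of a stream, followed from time `T` on by a burst of `N` unit jobs per unit
of time that lasts for `D` units of time. -/
noncomputable def burstInput (S : JobStream) (np : Bool) (N k : ℕ) (T : ℝ) (hT : S.r k ≤ T)
    (D : ℕ) : Input :=
  (S.burstAfter N k T hT).input np (k + 1 + N * D) (by omega)

variable {hT : S.r k ≤ T}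

theorem burstAfter_r_of_le {i : ℕ} (hi : i ≤ k) : (S.burstAfter N k T hT).r i = S.r i :=
  if_pos hi

theorem burstAfter_p_of_le {i : ℕ} (hi : i ≤ k) : (S.burstAfter N k T hT).p i = S.p i :=
  if_pos hi

theorem burstAfter_r_add (j : ℕ) :
    (S.burstAfter N k T hT).r (k + 1 + j) = T + (j / N : ℕ) := by
  simp [burstAfter, show ¬ k + 1 + j ≤ k by omega]

theorem burstAfter_p_add (j : ℕ) : (S.burstAfter N k T hT).p (k + 1 + j) = 1 :=
  if_neg (by omega)

theorem one_le_burstAfter_p (hp : ∀ i ≤ k, 1 ≤ S.p i) (i : ℕ) :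
    1 ≤ (S.burstAfter N k T hT).p i := by
  dsimp only [burstAfter]
  split_ifs with hi
  exacts [hp i hi, le_rfl]

theorem burstAfter_p_le {b : ℝ} (hb : 1 ≤ b) (hp : ∀ i ≤ k, S.p i ≤ b) (i : ℕ) :
    (S.burstAfter N k T hT).p i ≤ b := by
  dsimp only [burstAfter]
  split_ifs with hi
  exacts [hp i hi, hb]

theorem burstAfter_job_of_le {i : ℕ} (hi : i ≤ k) :
    (S.burstAfter N k T hT).job np i = S.job np i := by
  simp only [job, burstAfter_r_of_le hi, burstAfter_p_of_le hi]

theorem pmin_burstInput (hN : 0 < N) {D : ℕ} (hD : 0 < D) (hp : ∀ i ≤ k, 1 ≤ S.p i) :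
    (S.burstInput np N k T hT D).pmin = 1 := by
  have hlt : k + 1 + 0 < k + 1 + N * D := Nat.add_lt_add_left (Nat.mul_pos hN hD) _
  rw [burstInput, pmin_input hlt, burstAfter_p_add]
  intro i _
  rw [burstAfter_p_add]
  exact one_le_burstAfter_p hp i

theorem alpha_burstInput (hN : 0 < N) {D : ℕ} (hD : 0 < D) (hp : ∀ i ≤ k, 1 ≤ S.p i) {q : ℕ}
    (hq : q ≤ k) (hmax : ∀ i ≤ k, S.p i ≤ S.p q) :
    (S.burstInput np N k T hT D).alpha = S.p q := by
  rw [Input.alpha, pmin_burstInput hN hD hp, div_one, burstInput,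
    pmax_input (by omega : q < k + 1 + N * D), burstAfter_p_of_le hq]
  intro i _
  rw [burstAfter_p_of_le hq]
  exact burstAfter_p_le (hp q hq) hmax i

theorem beta_burstInput (hN : 0 < N) {D : ℕ} (hD : 0 < D) (hp : ∀ i ≤ k, 1 ≤ S.p i) {q : ℕ}
    (hq : q ≤ k) (hmax : ∀ i ≤ k, S.p i ≤ S.p q) :
    (S.burstInput true N k T hT D).beta = S.p q := by
  rw [Input.beta, pmin_burstInput hN hD hp, div_one, burstInput,
    eta_input (by omega : q < k + 1 + N * D), burstAfter_p_of_le hq]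
  intro i _
  rw [burstAfter_p_of_le hq]
  exact burstAfter_p_le (hp q hq) hmax i

theorem run_burstInput_eq (A : OnlineAlgorithm N) {n D : ℕ} {hn : 0 < n} (hk : k < n)
    (hrest : ∀ j, k < j → j < n → T ≤ S.r j) {t : ℝ} (ht : t < T) (m : Fin N) :
    A.run (S.burstInput np N k T hT D) m t = A.run (S.input np n hn) m t := by
  refine A.causal _ _ t ?_ m
  have hburst : ∀ i, k + 1 ≤ i → i < k + 1 + N * D → t < (S.burstAfter N k T hT).r i := by
    intro i hi _
    obtain ⟨j, rfl⟩ := Nat.exists_eq_add_of_le hi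
    rw [burstAfter_r_add]
    exact ht.trans_le (le_add_of_nonneg_right (Nat.cast_nonneg _))
  rw [burstInput, revealed_input (Nat.le_add_right _ _) hburst,
    revealed_input (Nat.succ_le_of_lt hk) fun i hi hin => ht.trans_le (hrest i hi hin)]
  congr 1
  exact List.map_congr_left fun i hi =>
    burstAfter_job_of_le (Nat.lt_succ_iff.1 (List.mem_range.1 hi))

theorem mul_sub_le_card_burst (N D : ℕ) {t : ℝ} (ht : t ∈ Icc T (T + D)) :
    N * (t - T) ≤ (#{j ∈ Finset.range (N * D) | T + (j / N : ℕ) ≤ t} : ℝ) := by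
  rcases ht.2.eq_or_lt with rfl | hlt
  · rw [Finset.filter_true_of_mem, Finset.card_range, Nat.cast_mul, add_sub_cancel_left]
    intro j hj
    gcongr
    exact (Nat.div_lt_of_lt_mul (Finset.mem_range.1 hj)).le
  · have ht₀ : 0 ≤ t - T := sub_nonneg.2 ht.1
    have hfloor : ⌊t - T⌋₊ + 1 ≤ D := (Nat.floor_lt ht₀).2 (by linarith)
    have hsub : Finset.range (N * (⌊t - T⌋₊ + 1)) ⊆
        {j ∈ Finset.range (N * D) | T + ((j / N : ℕ) : ℝ) ≤ t} := by
      intro j hj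
      have hj := Finset.mem_range.1 hj
      have hdiv : ((j / N : ℕ) : ℝ) ≤ t - T :=
        (Nat.le_floor_iff ht₀).1 (Nat.le_of_lt_succ (Nat.div_lt_of_lt_mul hj))
      exact Finset.mem_filter.2 ⟨Finset.mem_range.2 (hj.trans_le (by gcongr)), by linarith⟩
    calc (N : ℝ) * (t - T) ≤ N * (⌊t - T⌋₊ + 1) := by
          gcongr
          exact (Nat.lt_floor_add_one _).le
      _ = #(Finset.range (N * (⌊t - T⌋₊ + 1))) := by simp
      _ ≤ _ := by exact_mod_cast Finset.card_le_card hsub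

/-- During the burst `N` machines cannot do better than to finish unit jobs as fast as they are
released, and what they do for the earlier jobs is missing there. -/
theorem sum_le_pending_burst {D : ℕ} {σ : Schedule N}
    (hσ : Feasible (S.burstInput np N k T hT D) σ) {t : ℝ} (ht : t ∈ Icc T (T + D)) :
    ∑ i ∈ Finset.range (k + 1),
        (1 - σ.work (i, 0) t / S.p i + (σ.work (i, 0) t - σ.work (i, 0) T))
      ≤ (S.burstAfter N k T hT).pending (k + 1 + N * D) σ t := by
  have hbusy : ∑ i ∈ Finset.range (k + 1 + N * D), (σ.work (i, 0) t - σ.work (i, 0) T)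
      ≤ N * (t - T) := by
    simpa using hσ.sum_work_sub_work_le (Finset.range (k + 1 + N * D) ×ˢ {0}) ht.1
  have hunit (j : ℕ) (hj : j ∈ Finset.range (N * D)) :
      σ.work (k + 1 + j, 0) t - σ.work (k + 1 + j, 0) T = σ.work (k + 1 + j, 0) t := by
    rw [sub_eq_self]
    refine work_eq_zero hσ (Nat.add_lt_add_left (Finset.mem_range.1 hj) _) ?_
    rw [burstAfter_r_add]
    exact le_add_of_nonneg_right (Nat.cast_nonneg _)
  have hold : ∑ i ∈ Finset.range (k + 1), (if (S.burstAfter N k T hT).r i ≤ t then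
        1 - σ.work (i, 0) t / (S.burstAfter N k T hT).p i else 0)
      = ∑ i ∈ Finset.range (k + 1), (1 - σ.work (i, 0) t / S.p i) := by
    refine Finset.sum_congr rfl fun i hi => ?_
    have hi := Nat.lt_succ_iff.1 (Finset.mem_range.1 hi)
    rw [burstAfter_r_of_le hi, burstAfter_p_of_le hi, if_pos ((S.mono hi).trans (hT.trans ht.1))]
  have hnew : N * (t - T) - ∑ j ∈ Finset.range (N * D), σ.work (k + 1 + j, 0) t
      ≤ ∑ j ∈ Finset.range (N * D), (if (S.burstAfter N k T hT).r (k + 1 + j) ≤ t then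
        1 - σ.work (k + 1 + j, 0) t / (S.burstAfter N k T hT).p (k + 1 + j) else 0) := by
    refine (sub_le_sub_right (mul_sub_le_card_burst N D ht) _).trans ?_
    rw [Finset.card_filter, Nat.cast_sum, ← Finset.sum_sub_distrib]
    refine Finset.sum_le_sum fun j _ => ?_
    rw [burstAfter_r_add, burstAfter_p_add, div_one]
    split_ifs
    · rw [Nat.cast_one]
    · simpa using σ.work_nonneg (k + 1 + j, 0) t
  rw [Finset.sum_range_add, Finset.sum_congr (s₁ := Finset.range (N * D)) rfl hunit] at hbusy
  rw [pending, Finset.sum_filter, Finset.sum_range_add _ (k + 1) (N * D), hold,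
    Finset.sum_add_distrib]
  linarith

theorem pending_mul_le_cost_burst (hp : ∀ i ≤ k, 1 ≤ S.p i) (A : OnlineAlgorithm N) {n : ℕ}
    {hn : 0 < n} (hk : k < n) (hrest : ∀ j, k < j → j < n → T ≤ S.r j) (D : ℕ) :
    S.pending (k + 1) (A.run (S.input np n hn)) T * D
      ≤ cost (S.burstInput np N k T hT D) (A.run (S.burstInput np N k T hT D)) := by
  set σ := A.run (S.burstInput np N k T hT D)
  have hσ : Feasible (S.burstInput np N k T hT D) σ := A.feasible _
  have hsame (i : ℕ) : (A.run (S.input np n hn)).work (i, 0) T = σ.work (i, 0) T :=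
    Schedule.work_congr (fun t ht m => (run_burstInput_eq A hk hrest ht m).symm) _
  have hpending : ∀ t ∈ Icc T (T + D), S.pending (k + 1) (A.run (S.input np n hn)) T
      ≤ (S.burstAfter N k T hT).pending (k + 1 + N * D) σ t := by
    refine fun t ht => le_trans ?_ (sum_le_pending_burst hσ ht)
    rw [pending, Finset.filter_true_of_mem fun i hi =>
      (S.mono (Nat.lt_succ_iff.1 (Finset.mem_range.1 hi))).trans hT]
    refine Finset.sum_le_sum fun i hi => ?_
    have hp₁ := hp i (Nat.lt_succ_iff.1 (Finset.mem_range.1 hi))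
    have hmono := hσ.work_mono (i, 0) ht.1
    have hdiv : (σ.work (i, 0) t - σ.work (i, 0) T) / S.p i
        ≤ σ.work (i, 0) t - σ.work (i, 0) T := div_le_self (sub_nonneg.2 hmono) hp₁
    rw [sub_div] at hdiv
    rw [hsame]
    linarith
  simpa only [add_sub_cancel_left, burstInput] using
    mul_le_cost hσ (le_add_of_nonneg_right (Nat.cast_nonneg D)) hpending

theorem div_add_one_le_div_of_mod_eq {i j : ℕ} (hij : i < j) (h : i % N = j % N) :
    i / N + 1 ≤ j / N := by
  refine Nat.succ_le_of_lt (lt_of_le_of_ne (Nat.div_le_div_right hij.le) fun hdiv => hij.ne ?_)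
  rw [← Nat.div_add_mod i N, ← Nat.div_add_mod j N, hdiv, h]

/-- Extends a plan by a burst that is served as it arrives, job `j` of the burst on machine
`j % N`. -/
noncomputable def Plan.appendBurst (P : S.Plan N (k + 1)) (hT : S.r k ≤ T) (D : ℕ)
    (hP : ∀ i ≤ k, P.start i + S.p i ≤ T ∨ T + D ≤ P.start i) :
    (S.burstAfter N k T hT).Plan N (k + 1 + N * D) where
  machine i := if i ≤ k then P.machine i
    else ⟨(i - (k + 1)) % N, Nat.mod_lt _ (P.machine 0).pos⟩
  start i := if i ≤ k then P.start i else (S.burstAfter N k T hT).r i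
  release_le i _ := by
    split_ifs with hi
    · exact (burstAfter_r_of_le hi).trans_le (P.release_le i (by omega))
    · exact le_rfl
  separated i j hij hj hm := by
    rcases le_or_gt j k with hjk | hjk
    · have hik := hij.le.trans hjk
      simp only [if_pos hik, if_pos hjk, burstAfter_p_of_le hik, burstAfter_p_of_le hjk] at hm ⊢
      exact P.separated i j hij (by omega) hm
    obtain ⟨j, rfl⟩ := Nat.exists_eq_add_of_le (Nat.succ_le_of_lt hjk)
    rw [if_neg hjk.not_ge, burstAfter_r_add, burstAfter_p_add]
    rcases le_or_gt i k with hik | hik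
    · rw [if_pos hik, burstAfter_p_of_le hik]
      have hslot : ((j / N : ℕ) : ℝ) + 1 ≤ D := by
        exact_mod_cast Nat.succ_le_of_lt (Nat.div_lt_of_lt_mul (by omega : j < N * D))
      have hr : T ≤ T + ((j / N : ℕ) : ℝ) := le_add_of_nonneg_right (Nat.cast_nonneg _)
      exact (hP i hik).imp hr.trans' fun h => by linarith
    · obtain ⟨i, rfl⟩ := Nat.exists_eq_add_of_le (Nat.succ_le_of_lt hik)
      rw [if_neg hik.not_ge, burstAfter_r_add, burstAfter_p_add]
      simp only [if_neg hjk.not_ge, if_neg hik.not_ge, Fin.mk.injEq, Nat.succ_eq_add_one,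
        Nat.add_sub_cancel_left] at hm
      have hslot : ((i / N : ℕ) : ℝ) + 1 ≤ (j / N : ℕ) := by
        exact_mod_cast div_add_one_le_div_of_mod_eq (by omega) hm
      left
      linarith

theorem opt_burstInput_le (P : S.Plan N (k + 1)) (D : ℕ)
    (hP : ∀ i ≤ k, P.start i + S.p i ≤ T ∨ T + D ≤ P.start i) :
    opt N (S.burstInput np N k T hT D)
      ≤ ∑ i ∈ Finset.range (k + 1), (P.start i + S.p i - S.r i) + N * D := by
  refine ((P.appendBurst hT D hP).opt_le np (by omega)).trans_eq ?_
  rw [Finset.sum_range_add]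
  congr 1
  · refine Finset.sum_congr rfl fun i hi => ?_
    have hi := Nat.lt_succ_iff.1 (Finset.mem_range.1 hi)
    simp only [Plan.appendBurst, if_pos hi, burstAfter_r_of_le hi, burstAfter_p_of_le hi]
  · have hunit (j : ℕ) : (P.appendBurst hT D hP).start (k + 1 + j)
        + (S.burstAfter N k T hT).p (k + 1 + j) - (S.burstAfter N k T hT).r (k + 1 + j) = 1 := by
      simp only [Plan.appendBurst, if_neg (show ¬ k + 1 + j ≤ k by omega), burstAfter_p_add,
        add_sub_cancel_left]
    rw [Finset.sum_congr rfl fun j _ => hunit j]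
    simp

end JobStream

/-! ### The non-preemptive adversary -/

namespace JobStream

variable {S : JobStream} {N : ℕ} {T : ℝ} {hT : S.r 0 ≤ T}

theorem sq_div_four_le_cost_burst {np : Bool} {D : ℕ} {σ : Schedule N}
    (hσ : Feasible (S.burstInput np N 0 T hT D) σ) (hsub : Ioc T (T + D) ⊆ σ.served (0, 0)) :
    (D : ℝ) ^ 2 / 4 ≤ cost (S.burstInput np N 0 T hT D) σ := by
  have hhalf : T + D / 2 ≤ T + (D : ℝ) := by
    gcongr
    exact half_le_self (Nat.cast_nonneg D)
  have hpending : ∀ t ∈ Icc (T + D / 2) (T + D),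
      (D : ℝ) / 2 ≤ (S.burstAfter N 0 T hT).pending (0 + 1 + N * D) σ t := by
    intro t ht
    have hTt : T ≤ t := le_trans (le_add_of_nonneg_right (by positivity)) ht.1
    refine le_trans ?_ (sum_le_pending_burst hσ ⟨hTt, ht.2⟩)
    have hlong : σ.work (0, 0) t - σ.work (0, 0) T = t - T :=
      hσ.work_sub_work_of_Ioc_subset hTt ((Ioc_subset_Ioc_right ht.2).trans hsub)
    have hle : σ.work (0, 0) t / S.p 0 ≤ 1 := by
      rw [div_le_one (S.p_pos 0), ← burstAfter_p_of_le (hT := hT) le_rfl]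
      exact work_le hσ (by omega) t
    rw [zero_add, Finset.sum_range_one, hlong]
    linarith [ht.1]
  calc (D : ℝ) ^ 2 / 4 = D / 2 * (T + D - (T + D / 2)) := by ring
    _ ≤ cost (S.burstInput np N 0 T hT D) σ := mul_le_cost hσ hhalf hpending

/-- The plan for a single job that starts it at time `x`. -/
def Plan.single (S : JobStream) (hN : 0 < N) {x : ℝ} (hx : S.r 0 ≤ x) : S.Plan N 1 where
  machine _ := ⟨0, hN⟩
  start _ := x
  release_le i hi := by rwa [Nat.lt_one_iff.1 hi]
  separated i j hij hj := by omega

theorem opt_burstInput_zero_le {np : Bool} (hN : 0 < N) (D : ℕ) {x : ℝ} (hx : S.r 0 ≤ x)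
    (h : x + S.p 0 ≤ T ∨ T + D ≤ x) :
    opt N (S.burstInput np N 0 T hT D) ≤ x + S.p 0 - S.r 0 + N * D := by
  have hP : ∀ i ≤ 0, (Plan.single S hN hx).start i + S.p i ≤ T
      ∨ T + D ≤ (Plan.single S hN hx).start i := by
    intro i hi
    rwa [Nat.le_zero.1 hi]
  simpa [Plan.single] using opt_burstInput_le (hT := hT) (np := np) (Plan.single S hN hx) D hP

theorem served_run_burst_eq (A : OnlineAlgorithm N) {s : ℝ}
    (hs : (A.run (S.input true 1 one_pos)).served (0, 0) = Ico s (s + S.p 0)) (hT' : s < T)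
    (D : ℕ) :
    (A.run (S.burstInput true N 0 T hT D)).served (0, 0) = Ico s (s + S.p 0) := by
  obtain ⟨s', -, hs'⟩ := exists_served_eq_Ico (A.feasible (S.burstInput true N 0 T hT D))
    (i := 0) (by omega)
  rw [burstAfter_p_of_le le_rfl] at hs'
  have hp := S.p_pos 0
  have hsame := Schedule.served_inter_Iio_congr (fun t ht m =>
    run_burstInput_eq (np := true) (hT := hT) (D := D) (hn := one_pos) A one_pos
      (fun j h₁ h₂ => by omega) ht m) (0, 0)
  rw [hs, hs'] at hsame
  have hle : s' ≤ s := (hsame.ge ⟨⟨le_rfl, by linarith⟩, hT'⟩).1.1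
  have hge : s ≤ s' := (hsame.le ⟨⟨le_rfl, by linarith⟩, hle.trans_lt hT'⟩).1.1
  rw [hs', le_antisymm hle hge]

end JobStream

open JobStream

/-- Jobs of length `b`, all of them released at time `0`; only the first one is used. -/
def longJobs (b : ℝ) (hb : 0 < b) : JobStream where
  r _ := 0
  p _ := b
  r_nonneg _ := le_rfl
  p_pos _ := hb
  mono := monotone_const

theorem exists_nonpreemptive_ratio_ge {N : ℕ} (hN : 0 < N) (A : OnlineAlgorithm N) {k : ℕ}
    (hk : 0 < k) :
    ∃ ω ∈ singleTask true, ω.alpha = 2 * k + 2 ∧ ω.beta = 2 * k + 2 ∧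
      (2 * k + 2) / (16 * (N + 10)) ≤ cost ω (A.run ω) / opt N ω := by
  have hk₁ : (1 : ℝ) ≤ k := by exact_mod_cast hk
  have hlong : (1 : ℝ) ≤ 2 * k + 2 := by linarith
  let S : JobStream := longJobs (2 * k + 2) (by positivity)
  obtain ⟨s, hs₀, hserved⟩ := exists_served_eq_Ico
    (A.feasible (S.input true 1 one_pos)) one_pos
  change 0 ≤ s at hs₀
  have hT : S.r 0 ≤ s + 1 := hs₀.trans (le_add_of_nonneg_right zero_le_one)
  let ω : Input := S.burstInput true N 0 (s + 1) hT k
  have hfeasible : Feasible ω (A.run ω) := A.feasible ω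
  have hcost : (k : ℝ) ^ 2 / 4 ≤ cost ω (A.run ω) := by
    refine sq_div_four_le_cost_burst hfeasible ?_
    rw [served_run_burst_eq A hserved (lt_add_one s) k]
    change Ioc (s + 1) (s + 1 + k) ⊆ Ico s (s + (2 * k + 2))
    exact fun t ht => ⟨by linarith [ht.1], by linarith [ht.2]⟩
  have hopt : opt N ω ≤ (N + 10) * k := by
    rcases le_or_gt (2 * k + 2 : ℝ) s with hlate | hearly
    · have h : opt N ω ≤ 0 + (2 * k + 2) - 0 + N * k :=
        opt_burstInput_zero_le hN k le_rfl (Or.inl (show 0 + (2 * k + 2) ≤ s + 1 by linarith))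
      linarith
    · have h : opt N ω ≤ (s + 1 + k) + (2 * k + 2) - 0 + N * k :=
        opt_burstInput_zero_le hN k (hT.trans (le_add_of_nonneg_right (by positivity)))
          (Or.inr le_rfl)
      linarith
  refine ⟨ω, input_mem_singleTask,
    alpha_burstInput hN hk (fun _ _ => hlong) le_rfl fun _ _ => le_rfl,
    beta_burstInput hN hk (fun _ _ => hlong) le_rfl fun _ _ => le_rfl, ?_⟩
  calc (2 * k + 2 : ℝ) / (16 * (N + 10)) ≤ 4 * k / (16 * (N + 10)) := by gcongr; linarith
    _ = k ^ 2 / 4 / ((N + 10) * k) := by field_simp; norm_num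
    _ ≤ cost ω (A.run ω) / opt N ω :=
      div_le_div₀ (le_trans (by positivity) hcost) hcost hfeasible.opt_pos hopt

theorem not_ratioLittleO_beta {N : ℕ} (hN : 0 < N) (A : OnlineAlgorithm N) :
    ¬ RatioLittleO A (singleTask true) (fun _ β => β) := by
  refine not_ratioLittleO_of_forall_exists_ge (c := 1 / (16 * (N + 10))) (by positivity) fun M => ?_
  obtain ⟨k, hk⟩ := exists_nat_ge (max M 1)
  have hk₁ : (1 : ℝ) ≤ k := (le_max_right _ _).trans hk
  obtain ⟨ω, hω, -, hβ, hratio⟩ :=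
    exists_nonpreemptive_ratio_ge hN A (by exact_mod_cast hk₁ : 0 < k)
  refine ⟨ω, hω, ?_, ?_⟩
  · rw [hβ]
    linarith [(le_max_left M 1).trans hk]
  · rwa [hβ, one_div_mul_eq_div]

theorem not_ratioLittleO_log_alpha_add_beta {N : ℕ} (hN : 0 < N) (A : OnlineAlgorithm N) :
    ¬ RatioLittleO A univ (fun α β => Real.log α + β) := by
  refine not_ratioLittleO_of_forall_exists_ge (c := 1 / (32 * (N + 10))) (by positivity) fun M => ?_
  obtain ⟨k, hk⟩ := exists_nat_ge (max M 1)
  have hk₁ : (1 : ℝ) ≤ k := (le_max_right _ _).trans hk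
  obtain ⟨ω, -, hα, hβ, hratio⟩ :=
    exists_nonpreemptive_ratio_ge hN A (by exact_mod_cast hk₁ : 0 < k)
  have hlog_nonneg : 0 ≤ Real.log (2 * k + 2) := Real.log_nonneg (by linarith)
  have hlog_le : Real.log (2 * k + 2) ≤ 2 * k + 2 := Real.log_le_self (by positivity)
  refine ⟨ω, mem_univ ω, ?_, le_trans ?_ hratio⟩
  · rw [hα, hβ]
    linarith [(le_max_left M 1).trans hk]
  · rw [hα, hβ]
    calc 1 / (32 * (N + 10)) * (Real.log (2 * k + 2) + (2 * k + 2))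
        ≤ 1 / (32 * (N + 10)) * ((2 * k + 2) + (2 * k + 2)) := by gcongr
      _ = (2 * k + 2) / (16 * (N + 10)) := by field_simp; norm_num

/-! ### The preemptive adversary -/

/-- Length of the short jobs of phase `i` of the preemptive adversary, which goes through `n`
phases. The ratio `9` makes all the phases after a given one last together at most an eighth of
it. -/
noncomputable def shortLen (n i : ℕ) : ℝ := 9 ^ n / 9 ^ i

/-- Length of phase `i` of the preemptive adversary, and of its long job. -/
noncomputable def phaseLen (n i : ℕ) : ℝ := 2 * n * shortLen n i

/-- Start of phase `i` of the preemptive adversary: the geometric sum of the lengths of the earlier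
phases. -/
noncomputable def phaseStart (n i : ℕ) : ℝ := 9 / 8 * (phaseLen n 0 - phaseLen n i)

section Phases

variable {n i : ℕ}

theorem shortLen_pos (n i : ℕ) : 0 < shortLen n i := by unfold shortLen; positivity

theorem one_le_shortLen (h : i ≤ n) : 1 ≤ shortLen n i := by
  rw [shortLen, one_le_div (by positivity)]
  exact pow_le_pow_right₀ (by norm_num) h

theorem phaseLen_nonneg (n i : ℕ) : 0 ≤ phaseLen n i :=
  mul_nonneg (by positivity) (shortLen_pos n i).le

theorem phaseLen_succ (n i : ℕ) : phaseLen n (i + 1) = phaseLen n i / 9 := by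
  unfold phaseLen shortLen
  rw [pow_succ]
  field_simp

theorem phaseLen_zero (n : ℕ) : phaseLen n 0 = ((2 * n * 9 ^ n : ℕ) : ℝ) := by
  simp [phaseLen, shortLen]

theorem phaseLen_antitone (n : ℕ) : Antitone (phaseLen n) :=
  antitone_nat_of_succ_le fun i => by
    rw [phaseLen_succ]
    linarith [phaseLen_nonneg n i]

theorem shortLen_le_phaseLen (hn : 0 < n) (i : ℕ) : shortLen n i ≤ phaseLen n i := by
  have hn₁ : (1 : ℝ) ≤ n := by exact_mod_cast hn
  exact le_mul_of_one_le_left (shortLen_pos n i).le (by linarith)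

theorem phaseLen_pos (hn : 0 < n) (i : ℕ) : 0 < phaseLen n i :=
  (shortLen_pos n i).trans_le (shortLen_le_phaseLen hn i)

theorem phaseStart_zero (n : ℕ) : phaseStart n 0 = 0 := by simp [phaseStart]

theorem phaseStart_succ (n i : ℕ) : phaseStart n (i + 1) = phaseStart n i + phaseLen n i := by
  rw [phaseStart, phaseStart, phaseLen_succ]
  ring

theorem phaseStart_mono (n : ℕ) : Monotone (phaseStart n) :=
  monotone_nat_of_le_succ fun i => by
    rw [phaseStart_succ]
    exact le_add_of_nonneg_right (phaseLen_nonneg n i)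

theorem phaseStart_sub_le (n i : ℕ) :
    phaseStart n n - phaseStart n (i + 1) ≤ phaseLen n i / 8 := by
  rw [phaseStart, phaseStart, phaseLen_succ]
  linarith [phaseLen_nonneg n n]

theorem log_phaseLen_le (hn : 0 < n) : Real.log (phaseLen n 0) ≤ 10 * n := by
  have hlog_nine : Real.log 9 ≤ 9 - 1 := Real.log_le_sub_one_of_pos (by norm_num)
  calc Real.log (phaseLen n 0) = Real.log (2 * n) + n * Real.log 9 := by
        rw [phaseLen_zero, Nat.cast_mul, Nat.cast_pow,
          Real.log_mul (by positivity) (by positivity), Real.log_pow]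
        norm_num
    _ ≤ 2 * n + n * (9 - 1) := by
        gcongr
        exact Real.log_le_self (by positivity)
    _ = 10 * n := by ring

theorem le_log_phaseLen (hn : 0 < n) : (n : ℝ) ≤ Real.log (phaseLen n 0) := by
  have hn₁ : (1 : ℝ) ≤ n := by exact_mod_cast hn
  rw [Real.le_log_iff_exp_le (phaseLen_pos hn 0), ← Real.exp_one_pow]
  calc Real.exp 1 ^ n ≤ 9 ^ n := by
        gcongr
        linarith [Real.exp_one_lt_d9]
    _ ≤ 2 * n * 9 ^ n := le_mul_of_one_le_left (by positivity) (by linarith)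
    _ = phaseLen n 0 := by simp [phaseLen, shortLen]

end Phases

namespace JobStream

/-- The jobs of the preemptive adversary: phase `i` releases `N * n` short jobs and then one long
job, which have the consecutive indices `i * (N * n + 1), …, i * (N * n + 1) + N * n`. -/
noncomputable def phases (N n : ℕ) [NeZero n] : JobStream where
  r q := phaseStart n (q / (N * n + 1))
  p q := if q % (N * n + 1) < N * n then shortLen n (q / (N * n + 1))
    else phaseLen n (q / (N * n + 1))
  r_nonneg q := (phaseStart_zero n).symm.trans_le (phaseStart_mono n (Nat.zero_le _))
  p_pos q := by
    split_ifs
    exacts [shortLen_pos n _, phaseLen_pos (Nat.pos_of_neZero n) _]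
  mono _ _ h := phaseStart_mono n (Nat.div_le_div_right h)

/-- The index of the `j`-th job of phase `i`; the long job is the one with `j = N * n`. -/
def phaseIndex (N n i j : ℕ) : ℕ := i * (N * n + 1) + j

variable {N n i j : ℕ}

theorem phaseIndex_div (hj : j ≤ N * n) : phaseIndex N n i j / (N * n + 1) = i := by
  rw [phaseIndex, mul_comm, Nat.mul_add_div (Nat.succ_pos _), Nat.div_eq_of_lt (by omega),
    add_zero]

theorem phaseIndex_mod (hj : j ≤ N * n) : phaseIndex N n i j % (N * n + 1) = j := by
  rw [phaseIndex, mul_comm, Nat.mul_add_mod, Nat.mod_eq_of_lt (by omega)]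

theorem exists_eq_phaseIndex (N n q : ℕ) : ∃ i, ∃ j ≤ N * n, q = phaseIndex N n i j :=
  ⟨q / (N * n + 1), q % (N * n + 1), Nat.lt_succ_iff.1 (Nat.mod_lt _ (Nat.succ_pos _)),
    (Nat.div_add_mod' _ _).symm⟩

theorem phaseIndex_lt (hi : i < n) (hj : j ≤ N * n) :
    phaseIndex N n i j < n * (N * n + 1) := by
  have := Nat.mul_le_mul_right (N * n + 1) (Nat.succ_le_of_lt hi)
  rw [Nat.succ_mul] at this
  rw [phaseIndex]
  omega

theorem phase_le_of_phaseIndex_le {c : ℕ} (hj : j ≤ N * n)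
    (h : phaseIndex N n c j ≤ phaseIndex N n i (N * n)) : c ≤ i := by
  simpa only [phaseIndex_div hj, phaseIndex_div le_rfl] using
    Nat.div_le_div_right (c := N * n + 1) h

section Phases

variable [NeZero n]

theorem phases_r (hj : j ≤ N * n) : (phases N n).r (phaseIndex N n i j) = phaseStart n i := by
  simp only [phases, phaseIndex_div hj]

theorem phases_p_short (hj : j < N * n) :
    (phases N n).p (phaseIndex N n i j) = shortLen n i := by
  simp only [phases, phaseIndex_div hj.le, phaseIndex_mod hj.le, if_pos hj]

theorem phases_p_long : (phases N n).p (phaseIndex N n i (N * n)) = phaseLen n i := by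
  simp only [phases, phaseIndex_div le_rfl, phaseIndex_mod le_rfl, lt_irrefl, if_false]

theorem phases_p_le (q : ℕ) : (phases N n).p q ≤ phaseLen n 0 := by
  obtain ⟨i, j, hj, rfl⟩ := exists_eq_phaseIndex N n q
  refine le_trans ?_ (phaseLen_antitone n (Nat.zero_le i))
  rcases hj.lt_or_eq with hj | rfl
  · exact (phases_p_short hj).trans_le (shortLen_le_phaseLen (Nat.pos_of_neZero n) i)
  · exact phases_p_long.le

theorem one_le_phases_p (hi : i < n) {q : ℕ} (hq : q ≤ phaseIndex N n i (N * n)) :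
    1 ≤ (phases N n).p q := by
  obtain ⟨c, j, hj, rfl⟩ := exists_eq_phaseIndex N n q
  have hshort : 1 ≤ shortLen n c :=
    one_le_shortLen ((phase_le_of_phaseIndex_le hj hq).trans hi.le)
  rcases hj.lt_or_eq with hj | rfl
  · exact hshort.trans_eq (phases_p_short hj).symm
  · exact (hshort.trans (shortLen_le_phaseLen (Nat.pos_of_neZero n) c)).trans_eq phases_p_long.symm

theorem phaseStart_succ_le_phases_r {q : ℕ} (hq : phaseIndex N n i (N * n) < q) :
    phaseStart n (i + 1) ≤ (phases N n).r q := by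
  refine phaseStart_mono n ((Nat.le_div_iff_mul_le (Nat.succ_pos _)).2 ?_)
  rw [phaseIndex] at hq
  rw [Nat.succ_mul, Nat.succ_eq_add_one]
  omega

section Lower

variable {hn : 0 < n * (N * n + 1)} {σ : Schedule N}

theorem sum_work_phase_le (hσ : Feasible ((phases N n).input false _ hn) σ) (hi : i < n) {t : ℝ}
    (ht : phaseStart n i ≤ t) :
    ∑ j ∈ Finset.range (N * n + 1), σ.work (phaseIndex N n i j, 0) t
      ≤ N * (t - phaseStart n i) := by
  have hcapacity := hσ.sum_work_sub_work_le
    ((Finset.range (N * n + 1)).image fun j => (phaseIndex N n i j, 0)) ht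
  rw [Finset.sum_image fun a _ b _ h => by simpa [phaseIndex] using h] at hcapacity
  refine (Finset.sum_congr rfl fun j hj => ?_).trans_le hcapacity
  have hj := Nat.lt_succ_iff.1 (Finset.mem_range.1 hj)
  rw [work_eq_zero hσ (phaseIndex_lt hi hj) (phases_r hj).ge, sub_zero]

theorem sum_le_pending (hσ : Feasible ((phases N n).input false _ hn) σ) (hi : i < n) {t : ℝ}
    (ht : phaseStart n i ≤ t) {s : Finset ℕ} {f : ℕ → ℕ} (hf : Set.InjOn f s)
    (hs : ∀ a ∈ s, f a ≤ phaseIndex N n i (N * n)) :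
    ∑ a ∈ s, (1 - σ.work (f a, 0) t / (phases N n).p (f a))
      ≤ (phases N n).pending (phaseIndex N n i (N * n) + 1) σ t := by
  rw [pending, Finset.filter_true_of_mem, ← Finset.sum_image
    (f := fun q => 1 - σ.work (q, 0) t / (phases N n).p q) hf]
  · refine Finset.sum_le_sum_of_subset_of_nonneg ?_ fun q hq _ => ?_
    · exact Finset.image_subset_iff.2 fun a ha =>
        Finset.mem_range.2 (Nat.lt_succ_of_le (hs a ha))
    · have hlt := (Nat.lt_succ_iff.1 (Finset.mem_range.1 hq)).trans_lt (phaseIndex_lt hi le_rfl)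
      exact sub_nonneg.2 ((div_le_one ((phases N n).p_pos q)).2 (work_le hσ hlt t))
  · exact fun q hq => ((phases N n).mono (Nat.lt_succ_iff.1 (Finset.mem_range.1 hq))).trans
      ((phases_r le_rfl).trans_le ht)

theorem div_eight_le_pending_of_short_work_le (hσ : Feasible ((phases N n).input false _ hn) σ)
    (hi : i < n) {t : ℝ} (ht : phaseStart n i ≤ t)
    (hwork : ∑ j ∈ Finset.range (N * n), σ.work (phaseIndex N n i j, 0) t
      ≤ (N * n - n / 2) * shortLen n i) :
    (n : ℝ) / 8 ≤ (phases N n).pending (phaseIndex N n i (N * n) + 1) σ t := by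
  have hle : ∑ j ∈ Finset.range (N * n), σ.work (phaseIndex N n i j, 0) t / shortLen n i
      ≤ N * n - n / 2 := by
    rwa [← Finset.sum_div, div_le_iff₀ (shortLen_pos n i)]
  calc (n : ℝ) / 8 ≤ N * n - (N * n - n / 2) := by linarith [n.cast_nonneg (α := ℝ)]
    _ ≤ ∑ j ∈ Finset.range (N * n), (1 - σ.work (phaseIndex N n i j, 0) t / shortLen n i) := by
      simp only [Finset.sum_sub_distrib, Finset.sum_const, Finset.card_range, nsmul_eq_mul, mul_one,
        Nat.cast_mul]
      linarith
    _ = ∑ j ∈ Finset.range (N * n),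
        (1 - σ.work (phaseIndex N n i j, 0) t / (phases N n).p (phaseIndex N n i j)) :=
      Finset.sum_congr rfl fun j hj => by rw [phases_p_short (Finset.mem_range.1 hj)]
    _ ≤ _ := sum_le_pending hσ hi ht (fun a _ b _ h => by simpa [phaseIndex] using h)
        fun j hj => Nat.add_le_add_left (Finset.mem_range.1 hj).le _

/-- Short jobs that take almost the whole capacity of the first half of the phase leave at most
`phaseLen n i / 4` of it to the long job; the second half and all the later phases add at most
`phaseLen n i / 2 + phaseLen n i / 8`. -/
theorem long_work_le (hσ : Feasible ((phases N n).input false _ hn) σ) (hi : i < n)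
    (hwork : (N * n - n / 2) * shortLen n i ≤ ∑ j ∈ Finset.range (N * n),
      σ.work (phaseIndex N n i j, 0) (phaseStart n i + phaseLen n i / 2)) :
    σ.work (phaseIndex N n i (N * n), 0) (phaseStart n n) ≤ 7 / 8 * phaseLen n i := by
  have hlen := phaseLen_nonneg n i
  have hend : phaseStart n i + phaseLen n i ≤ phaseStart n n :=
    (phaseStart_succ n i).symm.trans_le (phaseStart_mono n hi)
  have hmid : σ.work (phaseIndex N n i (N * n), 0) (phaseStart n i + phaseLen n i / 2)
      ≤ phaseLen n i / 4 := by
    have hcapacity := sum_work_phase_le hσ hi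
      (le_add_of_nonneg_right (half_pos (phaseLen_pos (Nat.pos_of_neZero n) i)).le)
    rw [Finset.sum_range_succ] at hcapacity
    rw [phaseLen] at hcapacity hwork ⊢
    linarith
  have hlate := hσ.work_sub_work_le (phaseIndex N n i (N * n), 0)
    (show phaseStart n i + phaseLen n i / 2 ≤ phaseStart n n by linarith)
  have hrest := phaseStart_sub_le n i
  rw [phaseStart_succ] at hrest
  linarith

theorem div_eight_le_pending_of_long_work_le (hσ : Feasible ((phases N n).input false _ hn) σ)
    (hi : i + 1 = n) (hwork : ∀ c < n,
      σ.work (phaseIndex N n c (N * n), 0) (phaseStart n n) ≤ 7 / 8 * phaseLen n c) :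
    (n : ℝ) / 8 ≤ (phases N n).pending (phaseIndex N n i (N * n) + 1) σ (phaseStart n n) := by
  have hi' : i < n := by omega
  have hindex : ∀ c ∈ Finset.range n, phaseIndex N n c (N * n) ≤ phaseIndex N n i (N * n) :=
    fun c hc => Nat.add_le_add_right
      (Nat.mul_le_mul_right _ (by have := Finset.mem_range.1 hc; omega)) _
  calc (n : ℝ) / 8 = ∑ _c ∈ Finset.range n, (1 / 8 : ℝ) := by
        rw [Finset.sum_const, Finset.card_range, nsmul_eq_mul, mul_one_div]
    _ ≤ ∑ c ∈ Finset.range n, (1 - σ.work (phaseIndex N n c (N * n), 0) (phaseStart n n)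
          / (phases N n).p (phaseIndex N n c (N * n))) := by
      refine Finset.sum_le_sum fun c hc => ?_
      have hle := div_le_of_le_mul₀ (phaseLen_nonneg n c) (by norm_num)
        (hwork c (Finset.mem_range.1 hc))
      rw [phases_p_long]
      linarith
    _ ≤ _ := sum_le_pending hσ hi' (phaseStart_mono n hi'.le)
        (fun a _ b _ h => by simpa [phaseIndex] using h) hindex

theorem exists_pending_ge (hσ : Feasible ((phases N n).input false _ hn) σ) :
    ∃ i < n, ∃ T ∈ Icc (phaseStart n i + phaseLen n i / 2) (phaseStart n (i + 1)),
      (n : ℝ) / 8 ≤ (phases N n).pending (phaseIndex N n i (N * n) + 1) σ T := by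
  have hmid (i : ℕ) : phaseStart n i ≤ phaseStart n i + phaseLen n i / 2 :=
    le_add_of_nonneg_right (half_pos (phaseLen_pos (Nat.pos_of_neZero n) i)).le
  have hend (i : ℕ) : phaseStart n i + phaseLen n i / 2 ≤ phaseStart n (i + 1) := by
    rw [phaseStart_succ]
    linarith [phaseLen_nonneg n i]
  by_cases! hshort : ∃ i < n, ∑ j ∈ Finset.range (N * n),
      σ.work (phaseIndex N n i j, 0) (phaseStart n i + phaseLen n i / 2)
        ≤ (N * n - n / 2) * shortLen n i
  · obtain ⟨i, hi, hwork⟩ := hshort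
    exact ⟨i, hi, _, ⟨le_rfl, hend i⟩,
      div_eight_le_pending_of_short_work_le hσ hi (hmid i) hwork⟩
  obtain ⟨i, rfl⟩ := Nat.exists_eq_add_one.2 (Nat.pos_of_neZero n)
  exact ⟨i, Nat.lt_succ_self i, _, ⟨hend i, le_rfl⟩,
    div_eight_le_pending_of_long_work_le hσ rfl fun c hc => long_work_le hσ hc (hshort c hc).le⟩

end Lower

end Phases

end JobStream

namespace JobStream

variable {N n i c j : ℕ}

/-- The number of machines that the postponing plan for phase `i` uses for the short jobs of phase
`c`: in the earlier phases one machine is set aside for the long job. -/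
def shortMachines (N i c : ℕ) : ℕ := if c < i then N - 1 else N

theorem shortMachines_pos (hN : 2 ≤ N) (i c : ℕ) : 0 < shortMachines N i c := by
  unfold shortMachines
  split_ifs <;> omega

theorem shortMachines_le (N i c : ℕ) : shortMachines N i c ≤ N := by
  unfold shortMachines
  split_ifs <;> omega

/-- The machine of the `j`-th job of phase `c` in the postponing plan for phase `i`. -/
def postponeMachine (hN : 2 ≤ N) (n i c j : ℕ) : Fin N :=
  if j < N * n then
    ⟨N - shortMachines N i c + j % shortMachines N i c, by
      have := Nat.mod_lt j (shortMachines_pos hN i c)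
      have := shortMachines_le N i c
      omega⟩
  else ⟨0, by omega⟩

/-- The starting time of the `j`-th job of phase `c` in the plan for phase `i` that postpones the
long job of this phase until time `x`. -/
noncomputable def postponeStart (N n i : ℕ) (x : ℝ) (c j : ℕ) : ℝ :=
  if j < N * n then phaseStart n c + (j / shortMachines N i c : ℕ) * shortLen n c
  else if c < i then phaseStart n c else x

variable {x : ℝ}

theorem postponeMachine_short_eq_iff (hN : 2 ≤ N) {j' : ℕ} (hj : j < N * n) (hj' : j' < N * n) :
    postponeMachine hN n i c j = postponeMachine hN n i c j'
      ↔ j % shortMachines N i c = j' % shortMachines N i c := by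
  simp [postponeMachine, hj, hj']

theorem postponeMachine_short_ne_long (hN : 2 ≤ N) (hc : c < i) (hj : j < N * n) :
    postponeMachine hN n i c j ≠ postponeMachine hN n i c (N * n) := by
  simp only [postponeMachine, shortMachines, hj, hc, if_true, lt_irrefl, if_false, ne_eq,
    Fin.mk.injEq]
  omega

theorem postponeStart_short (hj : j < N * n) : postponeStart N n i x c j
    = phaseStart n c + (j / shortMachines N i c : ℕ) * shortLen n c :=
  if_pos hj

theorem postponeStart_long_of_lt (hc : c < i) :
    postponeStart N n i x c (N * n) = phaseStart n c := by
  rw [postponeStart, if_neg (lt_irrefl _), if_pos hc]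

theorem postponeStart_long_self : postponeStart N n i x i (N * n) = x := by
  rw [postponeStart, if_neg (lt_irrefl _), if_neg (lt_irrefl _)]

theorem phaseStart_le_postponeStart (hx : phaseStart n i + phaseLen n i / 2 ≤ x) (hc : c ≤ i)
    (hj : j ≤ N * n) : phaseStart n c ≤ postponeStart N n i x c j := by
  rcases hj.lt_or_eq with hj | rfl
  · rw [postponeStart_short hj]
    exact le_add_of_nonneg_right (mul_nonneg (Nat.cast_nonneg _) (shortLen_pos n c).le)
  rcases hc.lt_or_eq with hc | rfl
  · exact (postponeStart_long_of_lt hc).ge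
  · rw [postponeStart_long_self]
    linarith [phaseLen_nonneg n c]

section Plan

variable [NeZero n]

theorem postponeStart_add_short_le_of_lt (hN : 2 ≤ N) (hc : c < i) (hj : j < N * n) :
    postponeStart N n i x c j + (phases N n).p (phaseIndex N n c j) ≤ phaseStart n (c + 1) := by
  have hrounds : ((j / (N - 1) : ℕ) : ℝ) + 1 ≤ 2 * n := by
    obtain ⟨M, rfl⟩ := Nat.exists_eq_add_of_le' hN
    have hdiv : j / (M + 1) < 2 * n := Nat.div_lt_of_lt_mul (hj.trans_le (by ring_nf; omega))
    exact_mod_cast Nat.succ_le_of_lt hdiv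
  rw [postponeStart_short hj, phases_p_short hj, shortMachines, if_pos hc, phaseStart_succ,
    phaseLen]
  linarith [mul_le_mul_of_nonneg_right hrounds (shortLen_pos n c).le]

theorem postponeStart_add_short_le (hj : j < N * n) :
    postponeStart N n i x i j + (phases N n).p (phaseIndex N n i j)
      ≤ phaseStart n i + phaseLen n i / 2 := by
  have hrounds : ((j / N : ℕ) : ℝ) + 1 ≤ n := by
    exact_mod_cast Nat.succ_le_of_lt (Nat.div_lt_of_lt_mul hj)
  rw [postponeStart_short hj, phases_p_short hj, shortMachines, if_neg (lt_irrefl _), phaseLen]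
  linarith [mul_le_mul_of_nonneg_right hrounds (shortLen_pos n i).le]

theorem postponeStart_add_le_of_lt (hN : 2 ≤ N) (hc : c < i) (hj : j ≤ N * n) :
    postponeStart N n i x c j + (phases N n).p (phaseIndex N n c j) ≤ phaseStart n (c + 1) := by
  rcases hj.lt_or_eq with hj | rfl
  · exact postponeStart_add_short_le_of_lt hN hc hj
  · rw [postponeStart_long_of_lt hc, phases_p_long, phaseStart_succ]

theorem postponeStart_add_le_of_machine_eq (hN : 2 ≤ N)
    (hx : phaseStart n i + phaseLen n i / 2 ≤ x) (hc : c ≤ i) {j' : ℕ} (hjj' : j < j')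
    (hj' : j' ≤ N * n) (h : postponeMachine hN n i c j = postponeMachine hN n i c j') :
    postponeStart N n i x c j + (phases N n).p (phaseIndex N n c j)
      ≤ postponeStart N n i x c j' := by
  have hj : j < N * n := hjj'.trans_le hj'
  rcases hj'.lt_or_eq with hj' | rfl
  · have hmod := (postponeMachine_short_eq_iff hN hj hj').1 h
    have hround : ((j / shortMachines N i c : ℕ) : ℝ) + 1 ≤ (j' / shortMachines N i c : ℕ) := by
      exact_mod_cast div_add_one_le_div_of_mod_eq hjj' hmod
    rw [postponeStart_short hj, postponeStart_short hj', phases_p_short hj]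
    linarith [mul_le_mul_of_nonneg_right hround (shortLen_pos n c).le]
  rcases hc.lt_or_eq with hc | rfl
  · exact absurd h (postponeMachine_short_ne_long hN hc hj)
  · exact (postponeStart_add_short_le hj).trans (hx.trans_eq postponeStart_long_self.symm)

/-- The postponing plan: it serves all jobs of the first `i + 1` phases within their phase, except
for the long job of phase `i`, which is started at time `x`. -/
noncomputable def postponePlan (hN : 2 ≤ N) (hx : phaseStart n i + phaseLen n i / 2 ≤ x) :
    (phases N n).Plan N (phaseIndex N n i (N * n) + 1) where
  machine q := postponeMachine hN n i (q / (N * n + 1)) (q % (N * n + 1))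
  start q := postponeStart N n i x (q / (N * n + 1)) (q % (N * n + 1))
  release_le q hq := by
    obtain ⟨c, j, hj, rfl⟩ := exists_eq_phaseIndex N n q
    have hc := phase_le_of_phaseIndex_le hj (Nat.lt_succ_iff.1 hq)
    rw [phases_r hj, phaseIndex_div hj, phaseIndex_mod hj]
    exact phaseStart_le_postponeStart hx hc hj
  separated q q' hqq' hq' h := by
    obtain ⟨c, j, hj, rfl⟩ := exists_eq_phaseIndex N n q
    obtain ⟨c', j', hj', rfl⟩ := exists_eq_phaseIndex N n q'
    have hc' := phase_le_of_phaseIndex_le hj' (Nat.lt_succ_iff.1 hq')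
    have hcc' : c ≤ c' := by
      simpa only [phaseIndex_div hj, phaseIndex_div hj'] using
        Nat.div_le_div_right (c := N * n + 1) hqq'.le
    simp only [phaseIndex_div hj, phaseIndex_mod hj, phaseIndex_div hj', phaseIndex_mod hj'] at h ⊢
    left
    rcases hcc'.lt_or_eq with hlt | rfl
    · exact (postponeStart_add_le_of_lt hN (hlt.trans_le hc') hj).trans
        ((phaseStart_mono n hlt).trans (phaseStart_le_postponeStart hx hc' hj'))
    · exact postponeStart_add_le_of_machine_eq hN hx hc' (Nat.add_lt_add_iff_left.1 hqq') hj' h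

variable {hx : phaseStart n i + phaseLen n i / 2 ≤ x}

theorem postponePlan_start (hN : 2 ≤ N) (hj : j ≤ N * n) :
    (postponePlan hN hx).start (phaseIndex N n c j) = postponeStart N n i x c j := by
  simp only [postponePlan, phaseIndex_div hj, phaseIndex_mod hj]

theorem postponePlan_finish_le (hN : 2 ≤ N) {q : ℕ} (hq : q < phaseIndex N n i (N * n)) :
    (postponePlan hN hx).start q + (phases N n).p q ≤ phaseStart n i + phaseLen n i / 2 := by
  obtain ⟨c, j, hj, rfl⟩ := exists_eq_phaseIndex N n q
  rw [postponePlan_start hN hj]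
  rcases (phase_le_of_phaseIndex_le hj hq.le).lt_or_eq with hc | rfl
  · refine (postponeStart_add_le_of_lt hN hc hj).trans ((phaseStart_mono n hc).trans ?_)
    linarith [phaseLen_nonneg n i]
  · exact postponeStart_add_short_le (Nat.add_lt_add_iff_left.1 hq)

theorem postponePlan_response_le (hN : 2 ≤ N) {q : ℕ} (hq : q < phaseIndex N n i (N * n)) :
    (postponePlan hN hx).start q + (phases N n).p q - (phases N n).r q ≤ phaseLen n 0 := by
  obtain ⟨c, j, hj, rfl⟩ := exists_eq_phaseIndex N n q
  have hlen : phaseLen n c ≤ phaseLen n 0 := phaseLen_antitone n (Nat.zero_le c)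
  rw [phases_r hj]
  rcases (phase_le_of_phaseIndex_le hj hq.le).lt_or_eq with hc | rfl
  · have := postponeStart_add_le_of_lt (x := x) hN hc hj
    rw [phaseStart_succ] at this
    rw [postponePlan_start hN hj]
    linarith
  · have := postponePlan_finish_le (hx := hx) hN hq
    linarith [phaseLen_nonneg n c]

theorem opt_burstInput_phases_le (hN : 2 ≤ N) {T : ℝ}
    {hT : (phases N n).r (phaseIndex N n i (N * n)) ≤ T} {np : Bool}
    (hmem : T ∈ Icc (phaseStart n i + phaseLen n i / 2) (phaseStart n (i + 1))) (D : ℕ) :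
    opt N ((phases N n).burstInput np N (phaseIndex N n i (N * n)) T hT D)
      ≤ phaseIndex N n i (N * n) * phaseLen n 0 + (D + 2 * phaseLen n 0) + N * D := by
  have hx : phaseStart n i + phaseLen n i / 2 ≤ T + D :=
    hmem.1.trans (le_add_of_nonneg_right (Nat.cast_nonneg D))
  have hstart : (postponePlan hN hx).start (phaseIndex N n i (N * n)) = T + D := by
    rw [postponePlan_start hN le_rfl, postponeStart_long_self]
  have hclear : ∀ q ≤ phaseIndex N n i (N * n),
      (postponePlan hN hx).start q + (phases N n).p q ≤ T
        ∨ T + D ≤ (postponePlan hN hx).start q := by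
    intro q hq
    rcases hq.lt_or_eq with hq | rfl
    · exact Or.inl ((postponePlan_finish_le hN hq).trans hmem.1)
    · exact Or.inr hstart.ge
  refine (opt_burstInput_le (postponePlan hN hx) D hclear).trans ?_
  rw [Finset.sum_range_succ]
  gcongr
  · refine (Finset.sum_le_card_nsmul _ _ (phaseLen n 0) fun q hq =>
      postponePlan_response_le hN (Finset.mem_range.1 hq)).trans_eq ?_
    rw [Finset.card_range, nsmul_eq_mul]
  · rw [hstart, phases_p_long, phases_r le_rfl]
    have hend := hmem.2
    rw [phaseStart_succ] at hend
    linarith [phaseLen_antitone n (Nat.zero_le i)]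

/-- The length of the burst of the preemptive adversary, long enough for its unit jobs to dominate
the total response time of the plan that postpones a long job. -/
def burstLen (n : ℕ) : ℕ := n ^ 2 * (2 * n * 9 ^ n)

theorem burstLen_eq (n : ℕ) : (burstLen n : ℝ) = n ^ 2 * phaseLen n 0 := by
  rw [burstLen, phaseLen_zero, Nat.cast_mul, Nat.cast_pow]

theorem opt_burstInput_burstLen_le (hN : 2 ≤ N) (hi : i < n) {T : ℝ}
    {hT : (phases N n).r (phaseIndex N n i (N * n)) ≤ T} {np : Bool}
    (hmem : T ∈ Icc (phaseStart n i + phaseLen n i / 2) (phaseStart n (i + 1))) :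
    opt N ((phases N n).burstInput np N (phaseIndex N n i (N * n)) T hT (burstLen n))
      ≤ (2 * N + 4) * burstLen n := by
  have hn : (1 : ℝ) ≤ n := by exact_mod_cast Nat.pos_of_neZero n
  have hindex : (phaseIndex N n i (N * n) : ℝ) ≤ n * (N * n + 1) := by
    exact_mod_cast (phaseIndex_lt hi le_rfl).le
  have hlen := phaseLen_nonneg n 0
  calc opt N ((phases N n).burstInput np N (phaseIndex N n i (N * n)) T hT (burstLen n))
      ≤ phaseIndex N n i (N * n) * phaseLen n 0 + (burstLen n + 2 * phaseLen n 0)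
          + N * burstLen n := opt_burstInput_phases_le hN hmem _
    _ ≤ n * (N * n + 1) * phaseLen n 0 + (burstLen n + 2 * phaseLen n 0) + N * burstLen n := by
        gcongr
    _ = (2 * N + 1) * burstLen n + (n + 2) * phaseLen n 0 := by rw [burstLen_eq]; ring
    _ ≤ (2 * N + 1) * burstLen n + 3 * n ^ 2 * phaseLen n 0 := by gcongr; nlinarith
    _ = (2 * N + 4) * burstLen n := by rw [burstLen_eq]; ring

end Plan

end JobStream

theorem exists_preemptive_ratio_ge {N : ℕ} (hN : 2 ≤ N) (A : OnlineAlgorithm N) {n : ℕ}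
    (hn : 0 < n) :
    ∃ ω ∈ singleTask false, ω.alpha = phaseLen n 0 ∧
      n / (8 * (2 * N + 4)) ≤ cost ω (A.run ω) / opt N ω := by
  have : NeZero n := ⟨hn.ne'⟩
  obtain ⟨i, hi, T, hT, hpending⟩ := exists_pending_ge
    (A.feasible ((phases N n).input false (n * (N * n + 1)) (by positivity)))
  have hr : (phases N n).r (phaseIndex N n i (N * n)) ≤ T := by
    rw [phases_r le_rfl]
    linarith [hT.1, phaseLen_nonneg n i]
  have hp : ∀ q ≤ phaseIndex N n i (N * n), 1 ≤ (phases N n).p q :=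
    fun q hq => one_le_phases_p hi hq
  have hburst : 0 < burstLen n := by
    unfold burstLen
    positivity
  let ω : Input := (phases N n).burstInput false N (phaseIndex N n i (N * n)) T hr (burstLen n)
  have hcost : n / 8 * (burstLen n : ℝ) ≤ cost ω (A.run ω) :=
    (mul_le_mul_of_nonneg_right hpending (Nat.cast_nonneg _)).trans
      (pending_mul_le_cost_burst hp A (phaseIndex_lt hi le_rfl)
        (fun q hq _ => hT.2.trans (phaseStart_succ_le_phases_r hq)) _)
  have hopt : opt N ω ≤ (2 * N + 4) * burstLen n := opt_burstInput_burstLen_le hN hi hT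
  have hlong : (phases N n).p (phaseIndex N n 0 (N * n)) = phaseLen n 0 := phases_p_long
  refine ⟨ω, input_mem_singleTask, ?_, ?_⟩
  · have hfirst : phaseIndex N n 0 (N * n) ≤ phaseIndex N n i (N * n) := by
      simp [phaseIndex]
    rw [← hlong]
    exact alpha_burstInput (by omega) hburst hp hfirst
      fun q _ => (phases_p_le q).trans_eq hlong.symm
  · calc n / (8 * (2 * N + 4)) = n / 8 * (burstLen n : ℝ) / ((2 * N + 4) * burstLen n) := by
          field_simp
      _ ≤ cost ω (A.run ω) / opt N ω :=
        div_le_div₀ (le_trans (by positivity) hcost) hcost (A.feasible ω).opt_pos hopt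

theorem not_ratioLittleO_log_alpha {N : ℕ} (hN : 2 ≤ N) (A : OnlineAlgorithm N) :
    ¬ RatioLittleO A (singleTask false) (fun α _ => Real.log α) := by
  refine not_ratioLittleO_of_forall_exists_ge (c := 1 / (80 * (2 * N + 4))) (by positivity)
    fun M => ?_
  obtain ⟨n, hn⟩ := exists_nat_ge (max M 1)
  have hn₁ : (1 : ℝ) ≤ n := (le_max_right _ _).trans hn
  have hn₀ : 0 < n := by exact_mod_cast hn₁
  obtain ⟨ω, hω, hα, hratio⟩ := exists_preemptive_ratio_ge hN A hn₀
  refine ⟨ω, hω, ?_, le_trans ?_ hratio⟩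
  · rw [hα]
    exact ((le_max_left M 1).trans hn).trans (le_log_phaseLen hn₀)
  · rw [hα]
    calc 1 / (80 * (2 * N + 4)) * Real.log (phaseLen n 0)
        ≤ 1 / (80 * (2 * N + 4)) * (10 * n) := by
          gcongr
          exact log_phaseLen_le hn₀
      _ = n / (8 * (2 * N + 4)) := by field_simp; norm_num

end MPMS

theorem mainTheorem2 (N : ℕ) (hN : 1 ≤ N) :
    (¬ ∃ A : MPMS.OnlineAlgorithm N,
      MPMS.RatioLittleO A Set.univ (fun α β => Real.log α + β)) ∧
    (2 ≤ N → ¬ ∃ A : MPMS.OnlineAlgorithm N,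
      MPMS.RatioLittleO A (MPMS.singleTask false) (fun α _ => Real.log α)) ∧
    (¬ ∃ A : MPMS.OnlineAlgorithm N,
      MPMS.RatioLittleO A (MPMS.singleTask true) (fun _ β => β)) := by
  refine ⟨?_, fun hN₂ => ?_, ?_⟩
  · rintro ⟨A, hA⟩
    exact MPMS.not_ratioLittleO_log_alpha_add_beta hN A hA
  · rintro ⟨A, hA⟩
    exact MPMS.not_ratioLittleO_log_alpha hN₂ A hA
  · rintro ⟨A, hA⟩
    exact MPMS.not_ratioLittleO_beta hN A hA
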